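/- Work in the upper half-space model of the double hyperbolic plane $\mathbb{DH}^2$: the points are those of $\mathbb{R}^2=\{(x_0,x_1)\}$ together with one point at infinity; $\mathbb{H}^2$ is the part $x_0>0$ with the metric $(dx_0^2+dx_1^2)^{1/2}/x_0$, $\mathbb{H}^2_-$ is the part $x_0<0$, and their common boundary at infinity is the line $x_0=0$ together with the point at infinity. A closed half-space of $\mathbb{DH}^2$ is the closed inside or the closed outside (including the point at infinity) of a circle centered on $x_0=0$, or a closed Euclidean half-plane (including the point at infinity) whose boundary line is perpendicular to $x_0=0$. A polytope is a finite intersection of closed half-spaces. Let $P$ be a polytope in $\mathbb{DH}^2$ with non-empty interior that does not contain the point at infinity, and let $P_+=P\cap\{x_0>0\}$. A side of $P_+$ is an intersection, containing more than one point, of $P_+$ with the boundary of a closed half-space that contains $P$. Then $P_+$ has finitely many sides $s_1,\dots,s_m$ (in any order; parts of the line $x_0=0$ are not sides). For $i<j$ let $\theta_{ij}$ be the interior angle of $P_+$ between $s_i$ and $s_j$ if these sides meet at a point of $\mathbb{H}^2$ (in which case they are consecutive sides of $P_+$), and $\theta_{ij}=0$ if they do not meet in $\mathbb{H}^2$. Then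 the limit \[\mu_u(P)=\lim_{\epsilon\to 0^+}\int_{P}\frac{dx_0\,dx_1}{(x_0-\epsilon i)^2}\] exists and \[\mu_u(P)=2(m-2)\pi-2\sum_{i<j}\theta_{ij}.\] -/

import Mathlib

open MeasureTheory Filter Topology

/-- The Euclidean plane of the upper half-space model, with coordinates `(x 0, x 1)`;
the upper sheet `ℍ²` is `0 < x 0`, the lower sheet `ℍ²₋` is `x 0 < 0`, and the common boundary at
infinity is the line `x 0 = 0` together with the point at infinity. -/
abbrev Plane : Type := EuclideanSpace ℝ (Fin 2)

/-- The double hyperbolic plane `𝔻ℍ²` in the upper half-space model: the plane with one point at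
infinity added (a 2-sphere). -/
abbrev DH2 : Type := OnePoint Plane

/-- A closed half-space of `𝔻ℍ²`, given by its unit inward normal.  In the upper half-space model
it is `a (x₀² + x₁²) + b x₁ + c ≥ 0`, where `(a, b, c)` is a unit space-like vector for the Lorentz
form `b² - 4 a c`.  For `a < 0` this is the inside of the ball with center `(0, -b / (2 a))` and
radius `1 / (2 |a|)`, for `a > 0` it is the outside of that ball, and for `a = 0` (so `b = ± 1`) it
is one side of a line perpendicular to `x₀ = 0`.  Every ball centered on `x₀ = 0` and every such
line occurs, and distinct triples give distinct half-spaces. -/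
structure HalfSpace where
  a : ℝ
  b : ℝ
  c : ℝ
  unit_normal : b ^ 2 - 4 * a * c = 1

namespace HalfSpace

/-- The function whose non-negativity defines the half-space. -/
def eval (H : HalfSpace) (x : Plane) : ℝ :=
  H.a * (x 0 ^ 2 + x 1 ^ 2) + H.b * x 1 + H.c

/-- The half-space as a closed subset of `𝔻ℍ²`; it contains the point at infinity unless it is
the inside of a ball. -/
def carrier (H : HalfSpace) : Set DH2 :=
  (fun x : Plane => (x : DH2)) '' {x | 0 ≤ H.eval x} ∪ {p | p = OnePoint.infty ∧ 0 ≤ H.a}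

/-- The inward normal of the half-space at a point `x` of its boundary: the (Euclidean) gradient
of `H.eval` at `x`. -/
noncomputable def normal (H : HalfSpace) (x : Plane) : Plane :=
  !₂[2 * H.a * x 0, 2 * H.a * x 1 + H.b]

end HalfSpace

/-- A polytope in `𝔻ℍ²`: a finite intersection of closed half-spaces. -/
def IsPolytope (P : Set DH2) : Prop :=
  ∃ F : Set HalfSpace, F.Finite ∧ P = ⋂ H ∈ F, H.carrier

/-- The upper portion `P₊` of `P`, a subset of the open upper half-plane. -/
def upperPart (P : Set DH2) : Set Plane :=
  {x | 0 < x 0 ∧ (x : DH2) ∈ P}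

/-- The part of `P₊` lying on the boundary of the half-space `H`. -/
def sideOn (P : Set DH2) (H : HalfSpace) : Set Plane :=
  {x | x ∈ upperPart P ∧ H.eval x = 0}

/-- The sides of `P₊`.  A side is a one-dimensional intersection (that is, one with more than one
point) of `P₊` with the boundary of a half-space containing `P`; it is recorded by that half-space,
which it determines when `P` has non-empty interior. -/
def sides (P : Set DH2) : Set HalfSpace :=
  {H | P ⊆ H.carrier ∧ (sideOn P H).Nontrivial}

open scoped Classical in
/-- The dihedral angle between the sides of `P₊` recorded by `H` and `K`: if the two sides meet in
the upper half-plane, it is `π` minus the angle between the inward normals at the common point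
(unique for distinct sides; the model is conformal, so angles are Euclidean angles); if they do not
meet there, it is `0`. -/
noncomputable def dihedralAngle (P : Set DH2) (H K : HalfSpace) : ℝ :=
  if h : (sideOn P H ∩ sideOn P K).Nonempty then
    Real.pi - InnerProductGeometry.angle (H.normal h.some) (K.normal h.some)
  else 0

/-- The perturbed volume `μ_{u,ε}(P) = ∫_P dx₀ dx₁ / (x₀ - ε i)²`. -/
noncomputable def muEps (ε : ℝ) (P : Set DH2) : ℂ :=
  ∫ x in {x : Plane | (x : DH2) ∈ P}, 1 / ((x 0 : ℂ) - (ε : ℂ) * Complex.I) ^ 2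

/-- `μ_u(P)` exists and equals `L`, where `μ_u(P)` is the limit of `μ_{u,ε}(P)` as `ε → 0⁺`. -/
def HasMu (P : Set DH2) (L : ℂ) : Prop :=
  Tendsto (fun ε : ℝ => muEps ε P) (𝓝[>] 0) (𝓝 L)

/-! In the coordinates (x₀² + x₁², x₁) both sheets become the convex domain inside a parabola,
half-spaces become affine, and P becomes a convex polygon region. Call a side visible from a point
if the point lies strictly beyond its line. From a generic point outside P the visible sides form a
chain, so visible sides minus visible meeting pairs is 1; inside P it is 0
(`visible_sides_sub_visible_pairs`). Hence, almost everywhere, 1_P = 1 - ∑ 1_{O_i} + ∑ 1_{O_i ∩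
O_j}, where O_i is the complement of the i-th half-space and the last sum runs over pairs of sides
that meet in the upper sheet.

The terms on the right are not absolutely integrable over the plane in general, so they are
integrated in x₀ first and then in x₁ = v. A whole line contributes 0. A disc section (-h, h)
contributes -2h/(h² + ε²), which tends to -2/h, and 1/h is the derivative of an arcsine in v. Thus
O_i has mass -2π sign(a_i) (`hasIteratedMu_outside`). At each height the sections of two discs
through a common point e are nested, and the order switches at e; the arcsines there are the angles
of the normals, which gives the mass of a wedge (`hasIteratedMu_wedge`). Complementation extends
this to all signs of a.

The mass of a wedge is -2θ plus π(1 - sign a_i)(1 - sign a_j). These sign terms are summed by the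
same visibility identity taken near the point at infinity, which lies outside P
(`visible_count_infty`); this produces 2(m - 2)π. -/

/-! ### The one-dimensional kernel `1 / (x - ε i) ^ 2` -/

/-- The integrand of `muEps` as a function of `x₀`. -/
noncomputable def muKernel (ε x : ℝ) : ℂ := 1 / ((x : ℂ) - (ε : ℂ) * Complex.I) ^ 2

/-- The integral of the kernel over a horizontal section. -/
noncomputable def sectionIntegral (ε : ℝ) (A : Set ℝ) : ℂ := ∫ x in A, muKernel ε x

theorem sub_mul_I_ne_zero {ε : ℝ} (hε : 0 < ε) (x : ℝ) : (x : ℂ) - (ε : ℂ) * Complex.I ≠ 0 := by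
  intro h
  have := congrArg Complex.im h
  simp at this
  exact hε.ne' this

theorem continuous_muKernel {ε : ℝ} (hε : 0 < ε) : Continuous (muKernel ε) := by
  unfold muKernel
  refine continuous_const.div (by fun_prop) fun x => pow_ne_zero 2 (sub_mul_I_ne_zero hε x)

theorem norm_muKernel (ε x : ℝ) : ‖muKernel ε x‖ = (x ^ 2 + ε ^ 2)⁻¹ := by
  rw [muKernel, norm_div, norm_pow, norm_one, ← Complex.normSq_eq_norm_sq, Complex.normSq_apply,
    one_div]
  congr 1
  simp
  ring

theorem integrable_muKernel {ε : ℝ} (hε : 0 < ε) : Integrable (muKernel ε) := by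
  have h := (integrable_inv_one_add_sq.comp_mul_left' (inv_ne_zero hε.ne')).const_mul ((ε ^ 2)⁻¹)
  refine h.mono' (continuous_muKernel hε).aestronglyMeasurable (ae_of_all _ fun x => ?_)
  rw [norm_muKernel, ← mul_inv]
  apply le_of_eq
  congr 1
  field_simp
  ring

theorem hasDerivAt_muKernel_primitive {ε : ℝ} (hε : 0 < ε) (x : ℝ) :
    HasDerivAt (fun x : ℝ => -((x : ℂ) - (ε : ℂ) * Complex.I)⁻¹) (muKernel ε x) x := by
  have h1 : HasDerivAt (fun x : ℝ => (x : ℂ) - (ε : ℂ) * Complex.I) 1 x := by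
    simpa using (Complex.ofRealCLM.hasDerivAt (x := x)).sub_const ((ε : ℂ) * Complex.I)
  refine (h1.inv (sub_mul_I_ne_zero hε x)).neg.congr_deriv ?_
  rw [muKernel, neg_div, neg_neg]

/-- The primitive -1/(x - εi) vanishes at both ends. Consequently full sections may be added freely,
and passing to a complement only changes the sign. -/
theorem sectionIntegral_univ {ε : ℝ} (hε : 0 < ε) : sectionIntegral ε Set.univ = 0 := by
  have hb : ∀ l : Filter ℝ, Tendsto (fun x : ℝ => |x|) l atTop →
      Tendsto (fun x : ℝ => -((x : ℂ) - (ε : ℂ) * Complex.I)⁻¹) l (𝓝 0) := by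
    intro l hl
    rw [tendsto_zero_iff_norm_tendsto_zero]
    have : Tendsto (fun x : ℝ => |x|⁻¹) l (𝓝 0) := tendsto_inv_atTop_zero.comp hl
    refine squeeze_zero' (Eventually.of_forall fun x => norm_nonneg _) ?_ this
    filter_upwards [hl.eventually_gt_atTop 0] with x hx
    rw [norm_neg, norm_inv]
    refine inv_anti₀ hx ?_
    have := Complex.abs_re_le_norm ((x : ℂ) - (ε : ℂ) * Complex.I)
    simpa using this
  rw [sectionIntegral, setIntegral_univ, integral_of_hasDerivAt_of_tendsto
    (hasDerivAt_muKernel_primitive hε) (integrable_muKernel hε) (hb _ tendsto_abs_atBot_atTop)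
    (hb _ tendsto_abs_atTop_atTop), sub_zero]

/-- The symmetry of the interval cancels the imaginary part. For h > 0 a finite limit -2/h survives
as ε → 0, although 1/x² is not integrable at 0. -/
theorem sectionIntegral_Ioo {ε : ℝ} (hε : 0 < ε) {h : ℝ} (hh : 0 ≤ h) :
    sectionIntegral ε (Set.Ioo (-h) h) = ((-(2 * h / (h ^ 2 + ε ^ 2)) : ℝ) : ℂ) := by
  rw [sectionIntegral, ← integral_Ioc_eq_integral_Ioo, ← intervalIntegral.integral_of_le (by linarith),
    intervalIntegral.integral_eq_sub_of_hasDerivAt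
      (fun x _ => hasDerivAt_muKernel_primitive hε x) (integrable_muKernel hε).intervalIntegrable]
  have h1 := sub_mul_I_ne_zero hε h
  have h2 := sub_mul_I_ne_zero hε (-h)
  have h3 : ((h : ℂ) ^ 2 + (ε : ℂ) ^ 2) ≠ 0 := by
    have : h ^ 2 + ε ^ 2 ≠ 0 := by positivity
    exact_mod_cast this
  push_cast at h2 ⊢
  have e : (h : ℂ) ^ 2 + (ε : ℂ) ^ 2
      = -(((h : ℂ) - ε * Complex.I) * (-(h : ℂ) - ε * Complex.I)) := by
    linear_combination (ε : ℂ) ^ 2 * Complex.I_sq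
  rw [e]
  field_simp
  ring

theorem sectionIntegral_empty (ε : ℝ) : sectionIntegral ε ∅ = 0 := setIntegral_empty

/-! ### Integrating the kernel over a family of sections -/

/-- The iterated integral of the kernel over the sections `A v` tends to `L` as `ε → 0⁺`. -/
structure HasIteratedMu (A : ℝ → Set ℝ) (L : ℝ) : Prop where
  integrable : ∀ ε : ℝ, 0 < ε → Integrable fun v => sectionIntegral ε (A v)
  tendsto : Tendsto (fun ε => ∫ v, sectionIntegral ε (A v)) (𝓝[>] 0) (𝓝 (L : ℂ))

/-- Used with σ = 1 to glue families and with σ = -1 to subtract them. -/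
theorem HasIteratedMu.congr_ae {A B C : ℝ → Set ℝ} {K L : ℝ} (hA : HasIteratedMu A K)
    (hB : HasIteratedMu B L) (σ : ℝ)
    (h : ∀ ε > 0, ∀ᵐ v, sectionIntegral ε (C v)
      = sectionIntegral ε (A v) + σ * sectionIntegral ε (B v)) :
    HasIteratedMu C (K + σ * L) := by
  refine ⟨fun ε hε => ?_, ?_⟩
  · refine ((hA.integrable ε hε).add ((hB.integrable ε hε).const_mul (σ : ℂ))).congr ?_
    filter_upwards [h ε hε] with v hv
    simp [hv]
  · have : Tendsto (fun ε => (∫ v, sectionIntegral ε (A v))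
        + σ * ∫ v, sectionIntegral ε (B v)) (𝓝[>] 0) (𝓝 ((K + σ * L : ℝ) : ℂ)) := by
      push_cast
      exact hA.tendsto.add (hB.tendsto.const_mul _)
    refine this.congr' ?_
    filter_upwards [self_mem_nhdsWithin] with ε hε
    have hε : 0 < ε := hε
    rw [integral_congr_ae (h ε hε), integral_add (hA.integrable ε hε)
      ((hB.integrable ε hε).const_mul _), integral_const_mul]

theorem HasIteratedMu.zero : HasIteratedMu (fun _ => ∅) 0 := by
  constructor
  · intro ε _
    simp [sectionIntegral_empty]
  · simp [sectionIntegral_empty]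

/-! ### Circular arcs -/

/-- The arc-length density `1 / √(R² - (v - v₀)²)` of the hyperbolic line with radius
`R = 1 / (2 a)` and center `v₀ = - b / (2 a)`. -/
noncomputable def arcDensity (a b v : ℝ) : ℝ := 2 * a / √(1 - (2 * a * v + b) ^ 2)

theorem arcDensity_nonneg {a : ℝ} (ha : 0 < a) (b v : ℝ) : 0 ≤ arcDensity a b v := by
  unfold arcDensity; positivity

theorem hasDerivAt_arcsin_arc {a b v : ℝ} (h1 : 2 * a * v + b ≠ -1) (h2 : 2 * a * v + b ≠ 1) :
    HasDerivAt (fun v => Real.arcsin (2 * a * v + b)) (arcDensity a b v) v := by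
  have h : HasDerivAt (fun v : ℝ => 2 * a * v + b) (2 * a) v := by
    simpa using ((hasDerivAt_id v).const_mul (2 * a)).add_const b
  refine ((Real.hasDerivAt_arcsin h1 h2).comp v h).congr_deriv ?_
  unfold arcDensity
  ring

theorem integrable_arcDensity {a : ℝ} (ha : 0 < a) (b : ℝ) : Integrable (arcDensity a b) := by
  have h : IntegrableOn (arcDensity a b) (Set.Ioc ((-1 - b) / (2 * a)) ((1 - b) / (2 * a))) := by
    refine intervalIntegral.integrableOn_deriv_of_nonneg
      (g := fun v => Real.arcsin (2 * a * v + b)) (by fun_prop) ?_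
      fun x _ => arcDensity_nonneg ha b x
    intro x hx
    have h1 := (div_lt_iff₀ (by positivity)).1 hx.1
    have h2 := (lt_div_iff₀ (by positivity)).1 hx.2
    exact hasDerivAt_arcsin_arc (by linarith) (by linarith)
  -- Off the shadow of the disc the radicand is nonpositive, so the square root is 0 and the
  -- quotient takes the default value 0.
  refine h.integrable_of_forall_notMem_eq_zero fun v hv => ?_
  have : (1 - (2 * a * v + b) ^ 2) ≤ 0 := by
    rw [Set.mem_Ioc, not_and_or, not_lt, not_le, le_div_iff₀ (by positivity),
      div_lt_iff₀ (by positivity)] at hv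
    rcases hv with hv | hv <;> nlinarith
  rw [arcDensity, Real.sqrt_eq_zero_of_nonpos this, div_zero]

theorem intervalIntegral_arcDensity {a : ℝ} (ha : 0 < a) (b s t : ℝ) :
    ∫ v in s..t, arcDensity a b v
      = Real.arcsin (2 * a * t + b) - Real.arcsin (2 * a * s + b) := by
  refine integral_eq_of_hasDerivAt_off_countable (fun v => Real.arcsin (2 * a * v + b)) _
    (s := {(-1 - b) / (2 * a), (1 - b) / (2 * a)}) (Set.Countable.insert _ (Set.countable_singleton _))
    (by fun_prop) ?_ (integrable_arcDensity ha b).intervalIntegrable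
  rintro v ⟨-, hv⟩
  simp only [Set.mem_insert_iff, Set.mem_singleton_iff, not_or] at hv
  refine hasDerivAt_arcsin_arc (fun h => hv.1 ?_) (fun h => hv.2 ?_)
  · rw [eq_div_iff (by positivity)]; linarith
  · rw [eq_div_iff (by positivity)]; linarith

/-- `Real.arcsin` is constant below -1, so the integral from s to e no longer depends on s once s is
left of the disc. -/
theorem integral_Iic_arcDensity {a : ℝ} (ha : 0 < a) (b e : ℝ) :
    ∫ v in Set.Iic e, arcDensity a b v = Real.arcsin (2 * a * e + b) + Real.pi / 2 := by
  refine tendsto_nhds_unique (intervalIntegral_tendsto_integral_Iic e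
    (integrable_arcDensity ha b).integrableOn tendsto_id) ?_
  refine tendsto_const_nhds.congr' ?_
  filter_upwards [eventually_le_atBot ((-1 - b) / (2 * a))] with s hs
  rw [le_div_iff₀ (by positivity)] at hs
  rw [id, intervalIntegral_arcDensity ha, Real.arcsin_of_le_neg_one (x := 2 * a * s + b) (by linarith)]
  ring

theorem integral_Ioi_arcDensity {a : ℝ} (ha : 0 < a) (b e : ℝ) :
    ∫ v in Set.Ioi e, arcDensity a b v = Real.pi / 2 - Real.arcsin (2 * a * e + b) := by
  refine tendsto_nhds_unique (intervalIntegral_tendsto_integral_Ioi e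
    (integrable_arcDensity ha b).integrableOn tendsto_id) ?_
  refine tendsto_const_nhds.congr' ?_
  filter_upwards [eventually_ge_atTop ((1 - b) / (2 * a))] with s hs
  rw [div_le_iff₀ (by positivity)] at hs
  rw [id, intervalIntegral_arcDensity ha, Real.arcsin_of_one_le (x := 2 * a * s + b) (by linarith)]

/-! ### Open half-planes and their sections -/

namespace HalfSpace

/-- The section at height `v` of the complement of the half-space. -/
def outside (H : HalfSpace) (v : ℝ) : Set ℝ := {x | H.a * (x ^ 2 + v ^ 2) + H.b * v + H.c < 0}

theorem isOpen_outside (H : HalfSpace) (v : ℝ) : IsOpen (H.outside v) :=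
  isOpen_lt (by fun_prop) continuous_const

/-- Completing the square with `unit_normal`. When the horizontal line misses the disc the root is 0
and the interval is empty. -/
theorem outside_of_pos {H : HalfSpace} (ha : 0 < H.a) (v : ℝ) :
    H.outside v = Set.Ioo (-(√(1 - (2 * H.a * v + H.b) ^ 2) / (2 * H.a)))
      (√(1 - (2 * H.a * v + H.b) ^ 2) / (2 * H.a)) := by
  ext x
  have h : H.a * (x ^ 2 + v ^ 2) + H.b * v + H.c < 0
      ↔ (2 * H.a * x) ^ 2 < 1 - (2 * H.a * v + H.b) ^ 2 := by
    have := H.unit_normal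
    have e : (2 * H.a * x) ^ 2 - (1 - (2 * H.a * v + H.b) ^ 2)
        = 4 * H.a * (H.a * (x ^ 2 + v ^ 2) + H.b * v + H.c) := by linear_combination this
    rw [← sub_neg (a := (2 * H.a * x) ^ 2), e, mul_neg_iff]
    constructor
    · exact fun h => Or.inl ⟨by positivity, h⟩
    · rintro (h | h)
      · exact h.2
      · linarith [h.1]
  rw [outside, Set.mem_ofPred_eq, h, Real.sq_lt, Set.mem_Ioo, ← neg_div, div_lt_iff₀ (by positivity),
    lt_div_iff₀ (by positivity), mul_comm x]

theorem sectionIntegral_outside {H : HalfSpace} (ha : 0 < H.a) {ε : ℝ} (hε : 0 < ε) (v : ℝ) :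
    sectionIntegral ε (H.outside v)
      = ((-(2 * (√(1 - (2 * H.a * v + H.b) ^ 2) / (2 * H.a))
        / ((√(1 - (2 * H.a * v + H.b) ^ 2) / (2 * H.a)) ^ 2 + ε ^ 2)) : ℝ) : ℂ) := by
  rw [outside_of_pos ha, sectionIntegral_Ioo hε (by positivity)]

/-- Dominated convergence: with h the half-width of the section, 2h/(h² + ε²) ≤ 2/h, and 1/h is the
integrable arc density. -/
theorem hasIteratedMu_outside_inter {H : HalfSpace} (ha : 0 < H.a) {E : Set ℝ}
    (hE : MeasurableSet E) :
    HasIteratedMu (fun v => {x ∈ H.outside v | v ∈ E})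
      (-2 * ∫ v in E, arcDensity H.a H.b v) := by
  classical
  have key : ∀ ε : ℝ, 0 < ε → (fun v => sectionIntegral ε {x ∈ H.outside v | v ∈ E})
      = E.indicator fun v => sectionIntegral ε (H.outside v) := by
    intro ε _
    ext v
    by_cases hv : v ∈ E <;> simp [hv, sectionIntegral_empty]
  have hcont : ∀ ε : ℝ, 0 < ε → Continuous fun v => sectionIntegral ε (H.outside v) := by
    intro ε hε
    simp_rw [sectionIntegral_outside ha hε]
    refine Complex.continuous_ofReal.comp (Continuous.neg (Continuous.div (by fun_prop)
      (by fun_prop) fun v => by positivity))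
  have hbound : ∀ ε : ℝ, 0 < ε → ∀ v,
      ‖sectionIntegral ε (H.outside v)‖ ≤ 2 * arcDensity H.a H.b v := by
    intro ε hε v
    rw [sectionIntegral_outside ha hε, Complex.norm_real, norm_neg, Real.norm_of_nonneg
      (by positivity), arcDensity]
    set r := √(1 - (2 * H.a * v + H.b) ^ 2)
    rcases (Real.sqrt_nonneg (1 - (2 * H.a * v + H.b) ^ 2)).eq_or_lt' with h | h
    · simp [r, h]
    · change 0 < r at h
      rw [div_le_iff₀ (by positivity)]
      have : 2 * (2 * H.a / r) * ((r / (2 * H.a)) ^ 2 + ε ^ 2)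
          = 2 * (r / (2 * H.a)) + 2 * (2 * H.a / r) * ε ^ 2 := by
        field_simp
      rw [this]
      have : 0 ≤ 2 * (2 * H.a / r) * ε ^ 2 := by positivity
      linarith
  have hint := integrable_arcDensity ha H.b
  refine ⟨fun ε hε => ?_, ?_⟩
  · rw [key ε hε]
    exact ((hint.const_mul 2).mono' (hcont ε hε).aestronglyMeasurable
      (ae_of_all _ (hbound ε hε))).indicator hE
  · have h1 : Tendsto (fun ε : ℝ => ∫ v in E, sectionIntegral ε (H.outside v)) (𝓝[>] 0)
        (𝓝 (∫ v in E, ((-2 * arcDensity H.a H.b v : ℝ) : ℂ))) := by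
      refine tendsto_integral_filter_of_dominated_convergence (fun v => 2 * arcDensity H.a H.b v)
        ?_ ?_ (hint.const_mul 2).integrableOn (ae_of_all _ fun v => ?_)
      · filter_upwards [self_mem_nhdsWithin] with ε hε
        exact (hcont ε hε).aestronglyMeasurable
      · filter_upwards [self_mem_nhdsWithin] with ε hε
        exact ae_of_all _ (hbound ε hε)
      · set r := √(1 - (2 * H.a * v + H.b) ^ 2) with hr
        have hlim : Tendsto (fun ε : ℝ =>
            ((-(2 * (r / (2 * H.a)) / ((r / (2 * H.a)) ^ 2 + ε ^ 2)) : ℝ) : ℂ)) (𝓝[>] 0)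
            (𝓝 ((-2 * arcDensity H.a H.b v : ℝ) : ℂ)) := by
          refine (Complex.continuous_ofReal.tendsto _).comp ?_
          rw [arcDensity, ← hr]
          by_cases h : r = 0
          · simp [h]
          · have : -2 * (2 * H.a / r)
                = -(2 * (r / (2 * H.a)) / ((r / (2 * H.a)) ^ 2 + 0 ^ 2)) := by
              field_simp
              ring
            rw [this]
            refine Tendsto.mono_left (ContinuousAt.tendsto ?_) nhdsWithin_le_nhds
            refine ContinuousAt.neg (ContinuousAt.div (by fun_prop) (by fun_prop) ?_)
            have := ha.ne'
            positivity
        refine hlim.congr' ?_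
        filter_upwards [self_mem_nhdsWithin] with ε hε
        rw [sectionIntegral_outside ha hε]
    rw [integral_complex_ofReal, integral_const_mul] at h1
    refine h1.congr' ?_
    filter_upwards [self_mem_nhdsWithin] with ε hε
    rw [key ε hε, integral_indicator hE]

end HalfSpace

/-! ### Negligible boundaries and the mass of the complement of one half-space. -/

theorem finite_quadratic_zeros {a b c : ℝ} (h : a ≠ 0 ∨ b ≠ 0 ∨ c ≠ 0) :
    {x : ℝ | a * x ^ 2 + b * x + c = 0}.Finite := by
  have hp : (Polynomial.C a * Polynomial.X ^ 2 + Polynomial.C b * Polynomial.X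
      + Polynomial.C c : Polynomial ℝ) ≠ 0 := by
    intro h0
    have h2 := congrArg (Polynomial.coeff · 2) h0
    have h1 := congrArg (Polynomial.coeff · 1) h0
    have h3 := congrArg (Polynomial.coeff · 0) h0
    simp [Polynomial.coeff_X, Polynomial.coeff_C] at h1 h2 h3
    tauto
  refine (Polynomial.finite_setOfPred_isRoot hp).subset fun x hx => ?_
  simpa [Polynomial.IsRoot] using hx

namespace HalfSpace

/-- The opposite half-space. -/
def opp (H : HalfSpace) : HalfSpace := ⟨-H.a, -H.b, -H.c, by linarith [H.unit_normal]⟩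

theorem opp_opp (H : HalfSpace) : H.opp.opp = H := by
  cases H; simp [opp]

/-- For fixed v this is a nonzero polynomial in x, except when a = 0 and v is the height of the
boundary line. -/
theorem ae_ae_ne_zero (H : HalfSpace) :
    ∀ᵐ v : ℝ, ∀ᵐ x : ℝ, H.a * (x ^ 2 + v ^ 2) + H.b * v + H.c ≠ 0 := by
  have h0 : ∀ᵐ v : ℝ, ¬ (0 * v ^ 2 + H.b * v + H.c = 0 ∧ H.a = 0) := by
    by_cases ha : H.a = 0
    · have hb : H.b ≠ 0 := by
        intro hb
        simpa [ha, hb] using H.unit_normal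
      have := (finite_quadratic_zeros (a := 0) (b := H.b) (c := H.c)
        (Or.inr (Or.inl hb))).measure_zero volume
      filter_upwards [measure_eq_zero_iff_ae_notMem.1 this] with v hv h
      exact hv h.1
    · exact ae_of_all _ fun v h => ha h.2
  filter_upwards [h0] with v hv
  have hfin : {x : ℝ | H.a * x ^ 2 + 0 * x + (H.a * v ^ 2 + H.b * v + H.c) = 0}.Finite := by
    refine finite_quadratic_zeros ?_
    by_cases ha : H.a = 0
    · refine Or.inr (Or.inr fun h => hv ⟨?_, ha⟩)
      simpa [ha] using h
    · exact Or.inl ha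
  filter_upwards [measure_eq_zero_iff_ae_notMem.1 (hfin.measure_zero volume)] with x hx h
  exact hx (show _ = _ by linear_combination h)

theorem sectionIntegral_split (H : HalfSpace) {ε : ℝ} (hε : 0 < ε) {A : ℝ → Set ℝ} :
    ∀ᵐ v : ℝ, MeasurableSet (A v) → sectionIntegral ε (A v)
      = sectionIntegral ε (A v ∩ H.outside v) + sectionIntegral ε (A v ∩ H.opp.outside v) := by
  filter_upwards [H.ae_ae_ne_zero] with v hv hA
  have hd : Disjoint (A v ∩ H.outside v) (A v ∩ H.opp.outside v) := by
    refine Set.disjoint_left.2 fun x hx hx' => ?_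
    have h1 : H.a * (x ^ 2 + v ^ 2) + H.b * v + H.c < 0 := hx.2
    have h2 : -H.a * (x ^ 2 + v ^ 2) + -H.b * v + -H.c < 0 := hx'.2
    linarith
  rw [sectionIntegral, sectionIntegral, sectionIntegral, ← setIntegral_union hd
    (hA.inter (H.opp.isOpen_outside v).measurableSet) (integrable_muKernel hε).integrableOn
    (integrable_muKernel hε).integrableOn]
  refine setIntegral_congr_set ?_
  filter_upwards [hv] with x hx
  refine propext ⟨fun h => ?_, fun h => h.elim And.left And.left⟩
  rcases lt_or_gt_of_ne hx with h' | h'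
  · exact Or.inl ⟨h, h'⟩
  · refine Or.inr ⟨h, ?_⟩
    change -H.a * (x ^ 2 + v ^ 2) + -H.b * v + -H.c < 0
    linarith

theorem outside_of_eq_zero {H : HalfSpace} (ha : H.a = 0) (v : ℝ) :
    H.outside v = ∅ ∨ H.outside v = Set.univ := by
  by_cases h : H.b * v + H.c < 0
  · exact Or.inr (Set.eq_univ_of_forall fun x => by simpa [outside, ha] using h)
  · exact Or.inl (Set.eq_empty_of_forall_notMem fun x => by simpa [outside, ha] using h)

theorem hasIteratedMu_outside_Iic {H : HalfSpace} (ha : 0 < H.a) (e : ℝ) :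
    HasIteratedMu (fun v => {x ∈ H.outside v | v ∈ Set.Iic e})
      (-2 * (Real.arcsin (2 * H.a * e + H.b) + Real.pi / 2)) := by
  rw [← integral_Iic_arcDensity ha]
  exact hasIteratedMu_outside_inter ha measurableSet_Iic

theorem hasIteratedMu_outside_Ioi {H : HalfSpace} (ha : 0 < H.a) (e : ℝ) :
    HasIteratedMu (fun v => {x ∈ H.outside v | v ∈ Set.Ioi e})
      (-2 * (Real.pi / 2 - Real.arcsin (2 * H.a * e + H.b))) := by
  rw [← integral_Ioi_arcDensity ha]
  exact hasIteratedMu_outside_inter ha measurableSet_Ioi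

theorem hasIteratedMu_outside_of_pos {H : HalfSpace} (ha : 0 < H.a) :
    HasIteratedMu H.outside (-2 * Real.pi) := by
  have := (hasIteratedMu_outside_Iic ha 0).congr_ae (hasIteratedMu_outside_Ioi ha 0) 1
    (C := H.outside) fun ε hε => ae_of_all _ fun v => by
      by_cases hv : v ≤ 0
      · simp [hv, not_lt.2 hv, sectionIntegral_empty]
      · simp [hv, not_le.1 hv, sectionIntegral_empty]
  convert this using 1
  ring

/-- For a < 0 the region is, up to a null set, the complement of a disc, so its mass is the negative
of the disc's. For a = 0 every section is empty or a full line. -/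
theorem hasIteratedMu_outside (H : HalfSpace) :
    HasIteratedMu H.outside (-2 * Real.pi * (SignType.sign H.a : ℝ)) := by
  rcases lt_trichotomy H.a 0 with ha | ha | ha
  · have ha' : 0 < H.opp.a := neg_pos.2 ha
    have := HasIteratedMu.zero.congr_ae (hasIteratedMu_outside_of_pos ha') (-1) (C := H.outside)
      fun ε hε => by
        filter_upwards [H.sectionIntegral_split hε (A := fun _ => Set.univ)] with v hv
        have hv := hv MeasurableSet.univ
        rw [sectionIntegral_univ hε, Set.univ_inter, Set.univ_inter] at hv
        rw [sectionIntegral_empty]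
        push_cast
        linear_combination -hv
    convert this using 1
    simp [sign_neg ha]
  · have := HasIteratedMu.zero.congr_ae HasIteratedMu.zero 0 (C := H.outside)
      fun ε hε => ae_of_all _ fun v => by
        rcases outside_of_eq_zero ha v with h | h <;>
          simp [h, sectionIntegral_univ hε, sectionIntegral_empty]
    convert this using 1
    simp [ha]
  · convert hasIteratedMu_outside_of_pos ha using 1
    simp [sign_pos ha]

/-! ### Wedges -/

/-- The section at height `v` of the wedge opposite to the intersection of two half-spaces. -/
def wedge (H K : HalfSpace) (v : ℝ) : Set ℝ := H.outside v ∩ K.outside v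

theorem wedge_comm (H K : HalfSpace) : H.wedge K = K.wedge H :=
  funext fun _ => Set.inter_comm _ _

/-- The iterated volume of the wedge of `H` and `K` with apex `e`. -/
noncomputable def wedgeMu (H K : HalfSpace) (e : Plane) : ℝ :=
  2 * InnerProductGeometry.angle (H.normal e) (K.normal e) - Real.pi
    - Real.pi * (SignType.sign H.a : ℝ) - Real.pi * (SignType.sign K.a : ℝ)
    + Real.pi * (SignType.sign H.a : ℝ) * (SignType.sign K.a : ℝ)

theorem wedgeMu_comm (H K : HalfSpace) (e : Plane) : H.wedgeMu K e = K.wedgeMu H e := by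
  rw [wedgeMu, wedgeMu, InnerProductGeometry.angle_comm]
  ring

theorem normal_opp (H : HalfSpace) (e : Plane) : H.opp.normal e = -H.normal e := by
  ext i
  fin_cases i <;> simp [normal, opp]
  ring

theorem eval_opp (H : HalfSpace) (e : Plane) : H.opp.eval e = -H.eval e := by
  simp only [eval, opp]
  ring

/-- The boundary of `K` cuts the outside of `H` into the two wedges, while the angle of the normals
becomes its supplement; `wedgeMu` is compatible with this subtraction. -/
theorem hasIteratedMu_wedge_opp_right {H K : HalfSpace} {e : Plane}
    (h : HasIteratedMu (H.wedge K) (H.wedgeMu K e)) :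
    HasIteratedMu (H.wedge K.opp) (H.wedgeMu K.opp e) := by
  have := H.hasIteratedMu_outside.congr_ae h (-1) (C := H.wedge K.opp) fun ε hε => by
    filter_upwards [K.sectionIntegral_split hε (A := H.outside)] with v hv
    have hv := hv (H.isOpen_outside v).measurableSet
    push_cast
    rw [hv, wedge, wedge]
    ring
  convert this using 1
  rw [wedgeMu, wedgeMu, normal_opp, InnerProductGeometry.angle_neg_right]
  have : (SignType.sign K.opp.a : ℝ) = -(SignType.sign K.a : ℝ) := by
    rw [opp, Left.sign_neg]
    push_cast
    rfl
  rw [this]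
  ring

theorem normal_eq_cos_sin {H : HalfSpace} (ha : 0 ≤ H.a) {e : Plane} (he : 0 < e 0)
    (h : H.eval e = 0) :
    H.normal e = !₂[Real.cos (Real.arcsin (2 * H.a * e 1 + H.b)),
      Real.sin (Real.arcsin (2 * H.a * e 1 + H.b))] ∧ -1 ≤ 2 * H.a * e 1 + H.b ∧
      2 * H.a * e 1 + H.b ≤ 1 := by
  have h1 : (2 * H.a * e 0) ^ 2 + (2 * H.a * e 1 + H.b) ^ 2 = 1 := by
    have := H.unit_normal
    rw [eval] at h
    linear_combination 4 * H.a * h + this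
  have hs := abs_le.1 (abs_le_one_iff_mul_self_le_one.2
    (show (2 * H.a * e 1 + H.b) * (2 * H.a * e 1 + H.b) ≤ 1 by nlinarith))
  have hc : Real.cos (Real.arcsin (2 * H.a * e 1 + H.b)) = 2 * H.a * e 0 := by
    rw [Real.cos_arcsin, ← h1, add_sub_cancel_right, Real.sqrt_sq (by positivity)]
  rw [hc, Real.sin_arcsin hs.1 hs.2]
  exact ⟨rfl, hs⟩

theorem angle_cos_sin {s t : ℝ} (h0 : s ≤ t) (h1 : t - s ≤ Real.pi) :
    InnerProductGeometry.angle (!₂[Real.cos s, Real.sin s] : Plane) !₂[Real.cos t, Real.sin t]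
      = t - s := by
  have hn : ∀ u : ℝ, ‖(!₂[Real.cos u, Real.sin u] : Plane)‖ = 1 := by
    intro u
    simp [EuclideanSpace.norm_eq]
  rw [InnerProductGeometry.angle, hn, hn]
  have : inner ℝ (!₂[Real.cos s, Real.sin s] : Plane) !₂[Real.cos t, Real.sin t]
      = Real.cos (t - s) := by
    rw [Real.cos_sub]
    simp [PiLp.inner_apply, Fin.sum_univ_two]
  rw [this, mul_one, div_one, Real.arccos_cos (by linarith) h1]

/-- The sections of both discs are centered at 0, hence nested. By `hcross` the section of `H` is
the smaller one for v < e 1 and that of `K` for v > e 1, so the wedge is a piece of each disc cut at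
height e 1. -/
theorem hasIteratedMu_wedge_of_le {H K : HalfSpace} (hH : 0 < H.a)
    (hK : 0 < K.a ∨ (K.a = 0 ∧ K.b = 1)) {e : Plane} (he : 0 < e 0)
    (hHe : H.eval e = 0) (hKe : K.eval e = 0)
    (hlt : 2 * H.a * e 1 + H.b ≤ 2 * K.a * e 1 + K.b) (hcross : K.a * H.b < H.a * K.b) :
    HasIteratedMu (H.wedge K) (H.wedgeMu K e) := by
  have hKa : 0 ≤ K.a := by rcases hK with h | h; exacts [h.le, h.1.ge]
  obtain ⟨hnH, hH1, hH2⟩ := normal_eq_cos_sin hH.le he hHe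
  obtain ⟨hnK, hK1, hK2⟩ := normal_eq_cos_sin hKa he hKe
  have hang : InnerProductGeometry.angle (H.normal e) (K.normal e)
      = Real.arcsin (2 * K.a * e 1 + K.b) - Real.arcsin (2 * H.a * e 1 + H.b) := by
    rw [hnH, hnK]
    refine angle_cos_sin (Real.monotone_arcsin hlt) ?_
    linarith [Real.arcsin_le_pi_div_two (2 * K.a * e 1 + K.b),
      Real.neg_pi_div_two_le_arcsin (2 * H.a * e 1 + H.b)]
  have hright : HasIteratedMu (fun v => {x ∈ K.outside v | v ∈ Set.Ioi (e 1)})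
      (-2 * (Real.pi / 2 - Real.arcsin (2 * K.a * e 1 + K.b))) := by
    rcases hK with h | ⟨h0, h1⟩
    · exact hasIteratedMu_outside_Ioi h _
    -- When `K` is bounded by a line, its outside is v < e 1 and contributes nothing above e 1.
    · convert HasIteratedMu.zero using 1
      · ext v x
        simp only [Set.mem_ofPred_eq, outside, Set.mem_Ioi, Set.mem_empty_iff_false, iff_false]
        rw [eval] at hKe
        rintro ⟨hx, hv⟩
        simp only [h0, h1] at hKe hx
        linarith
      · simp [h0, h1]
  have := (hasIteratedMu_outside_Iic hH (e 1)).congr_ae hright 1 (C := H.wedge K) fun ε hε => by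
    filter_upwards [measure_eq_zero_iff_ae_notMem.1
      ((Set.finite_singleton (e 1)).measure_zero volume)] with v hv
    rw [eval] at hHe hKe
    rcases lt_or_gt_of_ne (show v ≠ e 1 from hv) with h | h
    · have hw : H.wedge K v = H.outside v := by
        refine Set.inter_eq_left.2 fun x hx => ?_
        change H.a * (x ^ 2 + v ^ 2) + H.b * v + H.c < 0 at hx
        change K.a * (x ^ 2 + v ^ 2) + K.b * v + K.c < 0
        -- Eliminating the quadratic terms between the two equations leaves an affine function of v
        -- which vanishes at e 1 and has slope H.a K.b - K.a H.b.
        have h3 : 0 < (e 1 - v) * (H.a * K.b - K.a * H.b) :=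
          mul_pos (by linarith) (by linarith)
        refine (mul_neg_iff.1 (?_ : H.a * (K.a * (x ^ 2 + v ^ 2) + K.b * v + K.c) < 0)).elim
          And.right fun h => absurd h.1 hH.le.not_gt
        have := mul_nonneg hKa (neg_nonneg.2 hx.le)
        nlinarith
      simp [hw, h.le, not_lt.2 h.le, sectionIntegral_empty]
    · have hw : H.wedge K v = K.outside v := by
        refine Set.inter_eq_right.2 fun x hx => ?_
        change K.a * (x ^ 2 + v ^ 2) + K.b * v + K.c < 0 at hx
        change H.a * (x ^ 2 + v ^ 2) + H.b * v + H.c < 0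
        rcases hK with hK | ⟨h0, h1⟩
        · have h3 : 0 < (v - e 1) * (H.a * K.b - K.a * H.b) :=
            mul_pos (by linarith) (by linarith)
          refine (mul_neg_iff.1 (?_ : K.a * (H.a * (x ^ 2 + v ^ 2) + H.b * v + H.c) < 0)).elim
            And.right fun h => absurd h.1 hK.le.not_gt
          have := mul_nonneg hH.le (neg_nonneg.2 hx.le)
          nlinarith
        · simp only [h0, h1] at hKe hx
          linarith
      simp [hw, h, not_le.2 h, sectionIntegral_empty]
  convert this using 1
  rw [wedgeMu, hang, sign_pos hH]
  rcases hK with h | ⟨h0, h1⟩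
  · simp [sign_pos h]
    ring
  · simp [h0, h1]
    ring

theorem ext_of_a_b {H K : HalfSpace} {e : Plane} (hHe : H.eval e = 0) (hKe : K.eval e = 0)
    (ha : H.a = K.a) (hb : H.b = K.b) : H = K := by
  rw [eval] at hHe hKe
  rcases H with ⟨a, b, c, h⟩
  rcases K with ⟨a', b', c', h'⟩
  simp only at ha hb hHe hKe
  subst ha hb
  have : c = c' := by linarith
  subst this
  rfl

theorem sq_normal_eq_one {H : HalfSpace} {e : Plane} (he : H.eval e = 0) :
    (2 * H.a * e 0) ^ 2 + (2 * H.a * e 1 + H.b) ^ 2 = 1 := by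
  have := H.unit_normal
  rw [eval] at he
  linear_combination 4 * H.a * he + this

/-- The normals at e are unit vectors in the right half-plane, with (0, -1) excluded by the
normalization b = 1. Their cross product is the sine of the angle between them, so its sign follows
from the order of their second coordinates. -/
theorem cross_lt_of_le {H K : HalfSpace}
    (hH : 0 < H.a ∨ (H.a = 0 ∧ H.b = 1)) (hK : 0 < K.a ∨ (K.a = 0 ∧ K.b = 1))
    {e : Plane} (he : 0 < e 0) (hHe : H.eval e = 0) (hKe : K.eval e = 0) (hne : H ≠ K)
    (hle : 2 * H.a * e 1 + H.b ≤ 2 * K.a * e 1 + K.b) : K.a * H.b < H.a * K.b := by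
  have hHa : 0 ≤ H.a := by rcases hH with h | h; exacts [h.le, h.1.ge]
  have hKa : 0 ≤ K.a := by rcases hK with h | h; exacts [h.le, h.1.ge]
  have hH1 := sq_normal_eq_one hHe
  have hK1 := sq_normal_eq_one hKe
  have hs : 2 * H.a * e 1 + H.b < 2 * K.a * e 1 + K.b := by
    refine lt_of_le_of_ne hle fun hs => hne ?_
    have h1 : (2 * H.a * e 0) ^ 2 = (2 * K.a * e 0) ^ 2 := by rw [hs] at hH1; linarith
    have h2 := (pow_left_inj₀ (by positivity) (by positivity) two_ne_zero).1 h1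
    have ha : H.a = K.a := by
      have := mul_right_cancel₀ he.ne' h2
      linarith
    refine ext_of_a_b hHe hKe ha ?_
    rw [ha] at hs
    linarith
  suffices h : (2 * K.a * e 0) * (2 * H.a * e 1 + H.b) < (2 * H.a * e 0) * (2 * K.a * e 1 + K.b) by
    have h' : 2 * e 0 * (K.a * H.b) < 2 * e 0 * (H.a * K.b) := by linarith
    exact lt_of_mul_lt_mul_left h' (by positivity)
  have hh : 0 ≤ 2 * H.a * e 0 := by positivity
  have hk : 0 ≤ 2 * K.a * e 0 := by positivity
  have hz : 2 * H.a * e 0 = 0 → 2 * H.a * e 1 + H.b = 1 := by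
    intro h
    rcases hH with hH | ⟨h0, h1⟩
    · exact absurd h (by positivity)
    · simp [h0, h1]
  generalize 2 * H.a * e 0 = h at *
  generalize 2 * K.a * e 0 = k at *
  generalize 2 * H.a * e 1 + H.b = s at *
  generalize 2 * K.a * e 1 + K.b = t at *
  rcases le_or_gt t 0 with ht | ht
  · have hkh : h < k := lt_of_pow_lt_pow_left₀ 2 hk (by nlinarith)
    nlinarith
  · rcases le_or_gt 0 s with hs0 | hs0
    · have hkh : k < h := lt_of_pow_lt_pow_left₀ 2 hh (by nlinarith)
      nlinarith
    · have hpos : 0 < h := lt_of_le_of_ne hh fun h0 => by linarith [hz h0.symm]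
      nlinarith

theorem hasIteratedMu_wedge_of_good {H K : HalfSpace}
    (hH : 0 < H.a ∨ (H.a = 0 ∧ H.b = 1)) (hK : 0 < K.a ∨ (K.a = 0 ∧ K.b = 1))
    {e : Plane} (he : 0 < e 0) (hHe : H.eval e = 0) (hKe : K.eval e = 0) (hne : H ≠ K) :
    HasIteratedMu (H.wedge K) (H.wedgeMu K e) := by
  wlog hle : 2 * H.a * e 1 + H.b ≤ 2 * K.a * e 1 + K.b generalizing H K
  · rw [wedge_comm, wedgeMu_comm]
    exact this hK hH hKe hHe hne.symm (not_le.1 hle).le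
  have hc := cross_lt_of_le hH hK he hHe hKe hne hle
  have hHa : 0 < H.a := by
    rcases hH with h | ⟨h0, h1⟩
    · exact h
    · rw [h0, h1] at hc
      rcases hK with h | h <;> linarith
  exact hasIteratedMu_wedge_of_le hHa hK he hHe hKe hle hc

theorem good_or_good_opp (H : HalfSpace) :
    (0 < H.a ∨ (H.a = 0 ∧ H.b = 1)) ∨ (0 < H.opp.a ∨ (H.opp.a = 0 ∧ H.opp.b = 1)) := by
  rcases lt_trichotomy H.a 0 with h | h | h
  · exact Or.inr (Or.inl (neg_pos.2 h))
  · have hb : H.b ^ 2 = 1 := by simpa [h] using H.unit_normal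
    rcases (by simpa using hb : H.b = 1 ∨ H.b = -1) with hb | hb <;> simp [opp, h, hb]
  · exact Or.inl (Or.inl h)

theorem hasIteratedMu_wedge {H K : HalfSpace} {e : Plane} (he : 0 < e 0) (hHe : H.eval e = 0)
    (hKe : K.eval e = 0) (hne : H ≠ K) (hne' : H ≠ K.opp) :
    HasIteratedMu (H.wedge K) (H.wedgeMu K e) := by
  have key : ∀ {H K : HalfSpace}, (0 < H.a ∨ (H.a = 0 ∧ H.b = 1)) → H.eval e = 0 →
      K.eval e = 0 → H ≠ K → H ≠ K.opp → HasIteratedMu (H.wedge K) (H.wedgeMu K e) := by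
    intro H K hH hHe hKe hne hne'
    rcases K.good_or_good_opp with hK | hK
    · exact hasIteratedMu_wedge_of_good hH hK he hHe hKe hne
    · rw [← K.opp_opp]
      exact hasIteratedMu_wedge_opp_right (hasIteratedMu_wedge_of_good hH hK he hHe
        (by rw [eval_opp, hKe, neg_zero]) hne')
  rcases H.good_or_good_opp with hH | hH
  · exact key hH hHe hKe hne hne'
  · rw [wedge_comm, wedgeMu_comm, ← H.opp_opp]
    refine hasIteratedMu_wedge_opp_right ?_
    rw [wedge_comm, wedgeMu_comm]
    refine key hH (by rw [eval_opp, hHe, neg_zero]) hKe (fun h => hne' ?_) fun h => hne ?_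
    · rw [← h, opp_opp]
    · rw [← H.opp_opp, h, opp_opp]

end HalfSpace

/-! ### The projective model

In the coordinates `(r, v) = (x₀² + x₁², x₁)` the upper sheet is the convex domain `v² < r` and
the half-spaces are affine. -/

/-- The upper sheet in projective coordinates. -/
def kleinDomain : Set (ℝ × ℝ) := {q | q.2 ^ 2 < q.1}

theorem isOpen_kleinDomain : IsOpen kleinDomain := isOpen_lt (by fun_prop) (by fun_prop)

theorem segment_mem_kleinDomain {p q : ℝ × ℝ} (hp : p ∈ kleinDomain) (hq : q ∈ kleinDomain)
    {s t : ℝ} (hs : 0 ≤ s) (ht : 0 ≤ t) (hst : s + t = 1) :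
    (s * p.1 + t * q.1, s * p.2 + t * q.2) ∈ kleinDomain := by
  change p.2 ^ 2 < p.1 at hp
  change q.2 ^ 2 < q.1 at hq
  change (s * p.2 + t * q.2) ^ 2 < s * p.1 + t * q.1
  have h1 : (s * p.2 + t * q.2) ^ 2 = s * p.2 ^ 2 + t * q.2 ^ 2 - s * t * (p.2 - q.2) ^ 2 := by
    have : s = 1 - t := by linarith
    subst this
    ring
  have h2 : 0 ≤ s * t * (p.2 - q.2) ^ 2 := by positivity
  rcases hs.eq_or_lt with h | h
  · have : t = 1 := by linarith
    subst this
    nlinarith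
  · have := mul_lt_mul_of_pos_left hp h
    have := mul_le_mul_of_nonneg_left hq.le ht
    linarith

/-- Finitely many non-zero affine functionals are simultaneously non-zero somewhere on every
non-empty open set. -/
theorem exists_mem_forall_affine_ne_zero {ι : Type*} [Finite ι] {U : Set (ℝ × ℝ)} (hU : IsOpen U)
    {y : ℝ × ℝ} (hy : y ∈ U) (α β γ : ι → ℝ) (h : ∀ i, α i ≠ 0 ∨ β i ≠ 0 ∨ γ i ≠ 0) :
    ∃ q ∈ U, ∀ i, α i * q.1 + β i * q.2 + γ i ≠ 0 := by
  -- On this parabola each functional becomes a nonzero quadratic in t, so it has no zeros for small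
  -- t > 0.
  have h1 : ∀ᶠ t : ℝ in 𝓝[>] 0, (y.1 + t, y.2 + t ^ 2) ∈ U := by
    have hc : ContinuousAt (fun t : ℝ => (y.1 + t, y.2 + t ^ 2)) 0 := by fun_prop
    refine (hc.eventually ?_).filter_mono nhdsWithin_le_nhds
    simpa using hU.mem_nhds hy
  have h2 : ∀ᶠ t : ℝ in 𝓝[>] 0, ∀ i, α i * (y.1 + t) + β i * (y.2 + t ^ 2) + γ i ≠ 0 := by
    rw [eventually_all]
    intro i
    have hfin := finite_quadratic_zeros (a := β i) (b := α i) (c := α i * y.1 + β i * y.2 + γ i)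
      (by
        by_contra! h0
        obtain ⟨hb, ha, hc⟩ := h0
        rw [ha, hb] at hc
        rcases h i with h | h | h
        · exact h ha
        · exact h hb
        · exact h (by linarith))
    have hcl := (hfin.subset (Set.sdiff_subset (t := {0}))).isClosed.isOpen_compl.mem_nhds
      (x := 0) (by simp)
    filter_upwards [nhdsWithin_le_nhds hcl, self_mem_nhdsWithin] with t ht ht0 h0
    have ht0 : (0 : ℝ) < t := ht0
    refine ht ⟨?_, ht0.ne'⟩
    change _ = _
    linear_combination h0
  obtain ⟨t, ht1, ht2⟩ := (h1.and h2).exists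
  exact ⟨_, ht1, ht2⟩

/-- With g and h the values of affine functions at the two ends of a segment, i minimizes the exit
time g/(g - h), equivalently g/(-h); clearing denominators gives the inequality. -/
theorem exists_first_exit {ι : Type*} [Finite ι] {g h : ι → ℝ} (hg : ∀ i, 0 ≤ g i)
    (hex : ∃ i, h i < 0) :
    ∃ i, h i < 0 ∧ ∀ j, 0 ≤ g i * h j - h i * g j := by
  obtain ⟨i, hi, hmin⟩ := Set.exists_min_image {i | h i < 0} (fun i => g i / -h i)
    (Set.toFinite _) hex
  have hi : h i < 0 := hi
  refine ⟨i, hi, fun j => ?_⟩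
  rcases le_or_gt 0 (h j) with hj | hj
  · nlinarith [mul_nonneg (hg i) hj, mul_nonneg (neg_nonneg.2 hi.le) (hg j)]
  · have := hmin j hj
    rw [div_le_div_iff₀ (by linarith) (by linarith)] at this
    linarith

namespace HalfSpace

/-- The affine functional defining the half-space in projective coordinates. -/
def lin (H : HalfSpace) (q : ℝ × ℝ) : ℝ := H.a * q.1 + H.b * q.2 + H.c

theorem continuous_lin (H : HalfSpace) : Continuous H.lin := by
  unfold lin; fun_prop

theorem lin_segment (H : HalfSpace) (p q : ℝ × ℝ) {s t : ℝ} (hst : s + t = 1) :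
    H.lin (s * p.1 + t * q.1, s * p.2 + t * q.2) = s * H.lin p + t * H.lin q := by
  have : s = 1 - t := by linarith
  subst this
  simp only [lin]
  ring

theorem sq_add_sq_pos (H : HalfSpace) : 0 < H.a ^ 2 + H.b ^ 2 := by
  have := H.unit_normal
  by_contra! h
  have ha : H.a = 0 := by nlinarith [sq_nonneg H.a, sq_nonneg H.b]
  have hb : H.b = 0 := by nlinarith [sq_nonneg H.a, sq_nonneg H.b]
  simp [ha, hb] at this

/-- An affine functional that vanishes at two points of the boundary line of `H` is a multiple of
`H.lin`. -/
theorem exists_eq_mul_lin (H : HalfSpace) {α β γ : ℝ} {p q : ℝ × ℝ} (hpq : p ≠ q)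
    (hp : H.lin p = 0) (hq : H.lin q = 0) (hp' : α * p.1 + β * p.2 + γ = 0)
    (hq' : α * q.1 + β * q.2 + γ = 0) :
    ∃ μ : ℝ, ∀ z : ℝ × ℝ, α * z.1 + β * z.2 + γ = μ * H.lin z := by
  have h1 : H.a * (q.1 - p.1) + H.b * (q.2 - p.2) = 0 := by
    simp only [lin] at hp hq; linarith
  have h2 : α * (q.1 - p.1) + β * (q.2 - p.2) = 0 := by linarith
  have hx : α * H.b = β * H.a := by
    have e1 : (q.1 - p.1) * (α * H.b - β * H.a) = 0 := by
      linear_combination H.b * h2 - β * h1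
    have e2 : (q.2 - p.2) * (α * H.b - β * H.a) = 0 := by
      linear_combination -H.a * h2 + α * h1
    rcases mul_eq_zero.1 e1 with h | h
    · rcases mul_eq_zero.1 e2 with h' | h'
      · exact absurd (Prod.ext (by linarith) (by linarith)) hpq
      · linarith
    · linarith
  have hn := H.sq_add_sq_pos.ne'
  refine ⟨(α * H.a + β * H.b) / (H.a ^ 2 + H.b ^ 2), fun z => ?_⟩
  have ea : α = (α * H.a + β * H.b) / (H.a ^ 2 + H.b ^ 2) * H.a := by
    rw [div_mul_eq_mul_div, eq_div_iff hn]
    linear_combination H.b * hx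
  have eb : β = (α * H.a + β * H.b) / (H.a ^ 2 + H.b ^ 2) * H.b := by
    rw [div_mul_eq_mul_div, eq_div_iff hn]
    linear_combination -H.a * hx
  set μ := (α * H.a + β * H.b) / (H.a ^ 2 + H.b ^ 2)
  simp only [lin] at hp ⊢
  linear_combination hp' - μ * hp + (z.1 - p.1) * ea + (z.2 - p.2) * eb

/-- The unit condition forces s² = t², and positivity at the common point y excludes s = -t. -/
theorem eq_of_mul_eq_mul {H K : HalfSpace} {s t : ℝ} (hs : s ≠ 0 ∨ t ≠ 0) (ha : s * H.a = t * K.a)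
    (hb : s * H.b = t * K.b) (hc : s * H.c = t * K.c) {y : ℝ × ℝ} (hH : 0 < H.lin y)
    (hK : 0 < K.lin y) : H = K := by
  have h2 : s ^ 2 = t ^ 2 := by
    linear_combination (-s ^ 2) * H.unit_normal + t ^ 2 * K.unit_normal
      + (s * H.b + t * K.b) * hb - 4 * s * H.c * ha - 4 * t * K.a * hc
  have h0 : s ≠ 0 := by
    rintro rfl
    rcases hs with h | h
    · exact h rfl
    · exact h (by simpa using h2.symm)
  have hl : s * H.lin y = t * K.lin y := by
    simp only [lin]
    linear_combination y.1 * ha + y.2 * hb + hc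
  rcases sq_eq_sq_iff_eq_or_eq_neg.1 h2 with rfl | rfl
  · have ha := mul_left_cancel₀ h0 ha
    have hb := mul_left_cancel₀ h0 hb
    have hc := mul_left_cancel₀ h0 hc
    cases H; cases K
    simp_all
  · have ht : t ≠ 0 := by simpa using h0
    have : t * (H.lin y + K.lin y) = 0 := by linarith
    rcases mul_eq_zero.1 this with h | h
    · exact absurd h ht
    · linarith

theorem eq_of_vanish {H K : HalfSpace} {p q : ℝ × ℝ} (hpq : p ≠ q) (hp : H.lin p = 0)
    (hq : H.lin q = 0) (hp' : K.lin p = 0) (hq' : K.lin q = 0) {y : ℝ × ℝ} (hH : 0 < H.lin y)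
    (hK : 0 < K.lin y) : H = K := by
  obtain ⟨μ, hμ⟩ := H.exists_eq_mul_lin hpq hp hq hp' hq'
  have h0 := hμ (0, 0)
  have h1 := hμ (1, 0)
  have h2 := hμ (0, 1)
  simp only [lin] at h0 h1 h2
  exact eq_of_mul_eq_mul (s := μ) (t := 1) (Or.inr one_ne_zero) (by linarith) (by linarith)
    (by linarith) hH hK

/-- The point at which the line through `y` and `x` crosses the boundary of `H`. -/
noncomputable def crossing (H : HalfSpace) (y x : ℝ × ℝ) : ℝ × ℝ :=
  (-H.lin x / (H.lin y - H.lin x) * y.1 + H.lin y / (H.lin y - H.lin x) * x.1,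
    -H.lin x / (H.lin y - H.lin x) * y.2 + H.lin y / (H.lin y - H.lin x) * x.2)

/-- The numerator is antisymmetric in `H` and `K`; when both boundaries are crossed on the way from
y to x, its sign tells which comes first. -/
theorem lin_crossing (H K : HalfSpace) {y x : ℝ × ℝ} (h : H.lin x < H.lin y) :
    K.lin (H.crossing y x)
      = (H.lin y * K.lin x - H.lin x * K.lin y) / (H.lin y - H.lin x) := by
  have h' : H.lin y - H.lin x ≠ 0 := by linarith
  rw [crossing, lin_segment]
  · ring
  · field_simp
    ring

theorem crossing_mem {H : HalfSpace} {y x : ℝ × ℝ} (hy : y ∈ kleinDomain) (hx : x ∈ kleinDomain)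
    (h : 0 ≤ H.lin y) (h' : H.lin x < 0) : H.crossing y x ∈ kleinDomain := by
  have h'' : H.lin y - H.lin x ≠ 0 := by linarith
  refine segment_mem_kleinDomain hy hx (div_nonneg (by linarith) (by linarith))
    (div_nonneg h (by linarith)) ?_
  field_simp
  ring

end HalfSpace

/-! ### Counting visible sides -/

/-- A sum over unordered pairs may be taken along any orientation of the pairs, not only the order
of `Fin m`; twice either sum is the sum over ordered pairs. -/
theorem sum_Ioi_eq_sum_of_total {m : ℕ} (g : Fin m → Fin m → ℝ) (hg : ∀ i j, g i j = g j i)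
    (R : Fin m → Fin m → Prop) [∀ i j, Decidable (R i j)] (hR : ∀ i j, i ≠ j → (R i j ↔ ¬ R j i)) :
    ∑ i, ∑ j ∈ Finset.Ioi i, g i j = ∑ i, ∑ j, if j ≠ i ∧ R i j then g i j else 0 := by
  have key : ∀ (S : Fin m → Fin m → Prop) [∀ i j, Decidable (S i j)],
      (∀ i j, i ≠ j → (S i j ↔ ¬ S j i)) →
      2 * (∑ i, ∑ j, if j ≠ i ∧ S i j then g i j else 0)
        = ∑ i, ∑ j, if j ≠ i then g i j else 0 := by
    intro S _ hS
    rw [two_mul]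
    nth_rewrite 2 [Finset.sum_comm]
    rw [← Finset.sum_add_distrib]
    refine Finset.sum_congr rfl fun i _ => ?_
    rw [← Finset.sum_add_distrib]
    refine Finset.sum_congr rfl fun j _ => ?_
    by_cases hij : i = j
    · simp [hij]
    · have := hS i j hij
      rw [hg j i]
      by_cases h : S i j
      · simp [h, this.1 h, hij, Ne.symm hij]
      · have h' : S j i := by_contra fun h' => h (this.2 h')
        simp [h, h', hij, Ne.symm hij]
  have h1 := key (fun i j => i < j) fun i j hij => by
    rw [not_lt]
    exact ⟨le_of_lt, fun h => lt_of_le_of_ne h hij⟩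
  have h2 := key R hR
  have h3 : ∑ i, ∑ j ∈ Finset.Ioi i, g i j = ∑ i, ∑ j, if j ≠ i ∧ i < j then g i j else 0 := by
    refine Finset.sum_congr rfl fun i _ => ?_
    rw [← Finset.sum_filter]
    refine Finset.sum_congr ?_ fun _ _ => rfl
    ext j
    simp only [Finset.mem_Ioi, Finset.mem_filter, Finset.mem_univ, true_and]
    exact ⟨fun h => ⟨h.ne', h⟩, And.right⟩
  rw [h3]
  linarith

/-- Two sides of the convex region cut out by the family `s` meet. -/
def Meets {ι : Type*} (s : ι → HalfSpace) (i j : ι) : Prop :=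
  ∃ q ∈ kleinDomain, (∀ k, 0 ≤ (s k).lin q) ∧ (s i).lin q = 0 ∧ (s j).lin q = 0

theorem Meets.symm {ι : Type*} {s : ι → HalfSpace} {i j : ι} (h : Meets s i j) : Meets s j i := by
  obtain ⟨q, h1, h2, h3, h4⟩ := h
  exact ⟨q, h1, h2, h4, h3⟩

section Counting

variable {ι : Type*} {s : ι → HalfSpace}

/-- The point z is chosen so that the segment to x never crosses two boundaries at once. Each
condition is affine in z, and is nontrivial because distinct sides are not proportional. -/
theorem exists_generic_center [Finite ι] (hs : Function.Injective s) {y : ℝ × ℝ}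
    (hy : y ∈ kleinDomain) (hpos : ∀ i, 0 < (s i).lin y) (x : ℝ × ℝ) :
    ∃ z ∈ kleinDomain, (∀ i, 0 < (s i).lin z) ∧
      ∀ i j, i ≠ j → (s i).lin x ≠ 0 →
        (s i).lin z * (s j).lin x - (s i).lin x * (s j).lin z ≠ 0 := by
  have hU : IsOpen (kleinDomain ∩ {q | ∀ i, 0 < (s i).lin q}) := by
    refine isOpen_kleinDomain.inter ?_
    have : {q | ∀ i, 0 < (s i).lin q} = ⋂ i, {q | 0 < (s i).lin q} := by ext; simp
    rw [this]
    exact isOpen_iInter_of_finite fun i => isOpen_lt continuous_const (s i).continuous_lin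
  obtain ⟨z, ⟨hz1, hz2⟩, hz3⟩ := exists_mem_forall_affine_ne_zero
    (ι := {ij : ι × ι // ij.1 ≠ ij.2 ∧ (s ij.1).lin x ≠ 0}) hU ⟨hy, hpos⟩
    (fun ij => (s ij.1.2).lin x * (s ij.1.1).a - (s ij.1.1).lin x * (s ij.1.2).a)
    (fun ij => (s ij.1.2).lin x * (s ij.1.1).b - (s ij.1.1).lin x * (s ij.1.2).b)
    (fun ij => (s ij.1.2).lin x * (s ij.1.1).c - (s ij.1.1).lin x * (s ij.1.2).c)
    (by
      rintro ⟨⟨i, j⟩, hij, hi⟩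
      by_contra! h
      exact hij (hs (HalfSpace.eq_of_mul_eq_mul (Or.inr hi) (sub_eq_zero.1 h.1)
        (sub_eq_zero.1 h.2.1) (sub_eq_zero.1 h.2.2) (hpos i) (hpos j))))
  refine ⟨z, hz1, hz2, fun i j hij hi h => hz3 ⟨⟨i, j⟩, hij, hi⟩ ?_⟩
  simp only [HalfSpace.lin] at h ⊢
  linear_combination h

/-- Beyond the end of a side there is exactly one neighbouring side. -/
theorem existsUnique_neighbor [Finite ι]
    (hm : ∀ i, ∃ p ∈ kleinDomain, (s i).lin p = 0 ∧ ∀ j, j ≠ i → 0 < (s j).lin p)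
    {i : ι} {z : ℝ × ℝ} (hz : z ∈ kleinDomain) (hzi : (s i).lin z = 0)
    (hex : ∃ j, (s j).lin z < 0) :
    ∃! j, Meets s i j ∧ (s j).lin z < 0 := by
  obtain ⟨p, hp, hpi, hpj⟩ := hm i
  have hp0 : ∀ j, 0 ≤ (s j).lin p := fun j => by
    by_cases h : j = i
    · rw [h, hpi]
    · exact (hpj j h).le
  have hpz : ∀ j, (s j).lin z < 0 → 0 < (s j).lin p := fun j hj =>
    hpj j (by rintro rfl; linarith)
  -- Walking along the line of side i from its relative interior point p to z, the first side left
  -- behind is the neighbour.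
  obtain ⟨j, hj, hmin⟩ := exists_first_exit (g := fun j => (s j).lin p)
    (h := fun j => (s j).lin z) hp0 hex
  have hlt : (s j).lin z < (s j).lin p := hj.trans_le (hp0 j)
  have hmj : Meets s i j := by
    refine ⟨(s j).crossing p z, HalfSpace.crossing_mem hp hz (hp0 j) hj, fun k => ?_, ?_, ?_⟩
    · rw [HalfSpace.lin_crossing _ _ hlt]
      exact div_nonneg (hmin k) (by linarith)
    · rw [HalfSpace.lin_crossing _ _ hlt, hpi, hzi]
      simp
    · rw [HalfSpace.lin_crossing _ _ hlt]
      simp [mul_comm]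
  refine ⟨j, ⟨hmj, hj⟩, ?_⟩
  have hne : p ≠ z := by rintro rfl; linarith
  -- Any neighbour violated at z is itself a first exit: on the line of side i, D equals d s_l - d'
  -- s_k, and at the common point of sides i and k this is d s_l ≥ 0.
  have key : ∀ {k l : ι}, Meets s i k → (s k).lin z < 0 →
      0 ≤ (s k).lin p * (s l).lin z - (s l).lin p * (s k).lin z := by
    rintro k l ⟨e, -, he0, hei, hek⟩ hk
    set d := (s k).lin p - (s k).lin z with hd
    set d' := (s l).lin p - (s l).lin z with hd'
    set D := (s k).lin p * (s l).lin z - (s l).lin p * (s k).lin z with hD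
    obtain ⟨μ, hμ⟩ := (s i).exists_eq_mul_lin (α := d * (s l).a - d' * (s k).a)
      (β := d * (s l).b - d' * (s k).b) (γ := d * (s l).c - d' * (s k).c - D) hne hpi hzi
      (by simp only [hd, hd', hD, HalfSpace.lin]; ring)
      (by simp only [hd, hd', hD, HalfSpace.lin]; ring)
    have h1 := hμ e
    have h2 : D = d * (s l).lin e - d' * (s k).lin e := by
      rw [hei] at h1
      simp only [HalfSpace.lin]
      linear_combination -h1
    rw [h2, hek, mul_zero, sub_zero]
    exact mul_nonneg (by linarith [hpz k hk]) (he0 l)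
  rintro k ⟨hk, hkz⟩
  by_contra hkj
  have hD : (s j).lin p * (s k).lin z - (s k).lin p * (s j).lin z = 0 :=
    le_antisymm (by linarith [key (l := j) hk hkz]) (key hmj hj)
  obtain ⟨μ, hμ⟩ := (s i).exists_eq_mul_lin
    (α := (s j).lin p * (s k).a - (s k).lin p * (s j).a)
    (β := (s j).lin p * (s k).b - (s k).lin p * (s j).b)
    (γ := (s j).lin p * (s k).c - (s k).lin p * (s j).c) hne hpi hzi
    (by simp only [HalfSpace.lin]; ring)
    (by rw [← hD]; simp only [HalfSpace.lin]; ring)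
  have hμ' : ∀ q, (s j).lin p * (s k).lin q - (s k).lin p * (s j).lin q = μ * (s i).lin q := by
    intro q
    rw [← hμ q]
    simp only [HalfSpace.lin]
    ring
  have hji : j ≠ i := by rintro rfl; linarith
  have hki : k ≠ i := by rintro rfl; linarith
  -- Two neighbours would leave at the same point, giving three concurrent side lines with one
  -- functional combining the other two. Relative interior points of sides j and k force opposite
  -- signs on μ.
  obtain ⟨u, -, hu0, hu⟩ := hm j
  obtain ⟨w, -, hw0, hw⟩ := hm k
  have h1 := hμ' u
  have h2 := hμ' w
  rw [hu0] at h1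
  rw [hw0] at h2
  have h3 := mul_pos (hpz j hj) (hu k hkj)
  have h4 := mul_pos (hpz k hkz) (hw j (Ne.symm hkj))
  have h5 : 0 < μ := pos_of_mul_pos_left (by linarith) (hu i hji.symm).le
  have h6 := mul_pos h5 (hw i hki.symm)
  linarith


end Counting

open scoped Classical in
/-- Seen from a point off the side lines, the number of visible sides minus the number of visible
pairs of adjacent sides is `1` outside the region and `0` inside. -/
theorem visible_sides_sub_visible_pairs {m : ℕ} {s : Fin m → HalfSpace}
    (hs : Function.Injective s) {y : ℝ × ℝ} (hy : y ∈ kleinDomain)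
    (hpos : ∀ i, 0 < (s i).lin y)
    (hm : ∀ i, ∃ p ∈ kleinDomain, (s i).lin p = 0 ∧ ∀ j, j ≠ i → 0 < (s j).lin p)
    {x : ℝ × ℝ} (hxd : x ∈ kleinDomain) (hx : ∀ i, (s i).lin x ≠ 0) :
    (∑ i, if (s i).lin x < 0 then (1 : ℝ) else 0)
      - ∑ i, ∑ j ∈ Finset.Ioi i,
        (if Meets s i j ∧ (s i).lin x < 0 ∧ (s j).lin x < 0 then (1 : ℝ) else 0)
      = if ∀ i, 0 ≤ (s i).lin x then 0 else 1 := by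
  -- The segment from z to x meets the line of each visible side i at a point c_i, and D i j < 0
  -- means that c_i is beyond side j. As D is antisymmetric and nonzero where needed, it orients the
  -- pairs.
  obtain ⟨z, hz, hz0, hD⟩ := exists_generic_center hs hy hpos x
  set D : Fin m → Fin m → ℝ :=
    fun i j => (s i).lin z * (s j).lin x - (s i).lin x * (s j).lin z with hDdef
  have hanti : ∀ i j, D j i = -D i j := fun i j => by simp only [hDdef]; ring
  rw [sum_Ioi_eq_sum_of_total _ (fun i j => ?_) (fun i j => D i j < 0), ← Finset.sum_sub_distrib]
  rotate_left
  · intro i j hij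
    rw [hanti i j, neg_lt_zero, not_lt]
    exact ⟨le_of_lt, fun h => lt_of_le_of_ne h (hD i j hij (hx i))⟩
  · refine if_congr ⟨fun h => ⟨h.1.symm, h.2.2, h.2.1⟩, fun h => ⟨h.1.symm, h.2.2, h.2.1⟩⟩ rfl rfl
  -- If c_i is not in the region, side i is cancelled by the pair with its unique neighbour beyond
  -- which c_i lies. Only a side through which the segment leaves the region survives.
  have hterm : ∀ i, (if (s i).lin x < 0 then (1 : ℝ) else 0)
      - ∑ j, (if j ≠ i ∧ D i j < 0 then
        (if Meets s i j ∧ (s i).lin x < 0 ∧ (s j).lin x < 0 then (1 : ℝ) else 0) else 0)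
      = if (s i).lin x < 0 ∧ ∀ j, 0 ≤ D i j then 1 else 0 := by
    intro i
    by_cases hi : (s i).lin x < 0
    swap
    · simp [hi]
    have hlt : (s i).lin x < (s i).lin z := hi.trans (hz0 i)
    have hsign : ∀ j, (s j).lin ((s i).crossing z x) < 0 ↔ D i j < 0 := fun j => by
      rw [HalfSpace.lin_crossing _ _ hlt, div_lt_iff₀ (by linarith), zero_mul]
    by_cases hall : ∀ j, 0 ≤ D i j
    · rw [Finset.sum_eq_zero fun j _ => if_neg fun h => (hall j).not_gt h.2]
      simp [hi, hall]
    · push Not at hall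
      obtain ⟨j, ⟨hj1, hj2⟩, huniq⟩ := existsUnique_neighbor hm (i := i)
        (HalfSpace.crossing_mem hz hxd (hz0 i).le hi)
        (by rw [HalfSpace.lin_crossing _ _ hlt]; simp [mul_comm])
        (hall.imp fun j hj => (hsign j).2 hj)
      rw [hsign] at hj2
      have hne : ∀ k, D i k < 0 → k ≠ i := by
        rintro k hk rfl
        simp [hDdef, mul_comm] at hk
      have hneg : ∀ k, D i k < 0 → (s k).lin x < 0 := fun k hk => by
        by_contra! h
        have h1 := mul_nonneg (hz0 i).le h
        have h2 := mul_pos (neg_pos.2 hi) (hz0 k)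
        simp only [hDdef] at hk
        linarith
      rw [Finset.sum_eq_single j]
      · rw [if_pos hi, if_pos ⟨hne j hj2, hj2⟩, if_pos ⟨hj1, hi, hneg j hj2⟩, sub_self, if_neg]
        exact fun h => (h.2 j).not_gt hj2
      · intro k _ hkj
        refine ite_eq_right_iff.2 fun hk => if_neg fun h => hkj (huniq k ⟨h.1, (hsign k).2 hk.2⟩)
      · simp
  rw [Finset.sum_congr rfl fun i _ => hterm i]
  split_ifs with hall
  · exact Finset.sum_eq_zero fun i _ => if_neg fun h => (hall i).not_gt h.1
  · push Not at hall
    -- The segment exits somewhere, and by genericity through a single side.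
    obtain ⟨i, hi, hmin⟩ := exists_first_exit (g := fun i => (s i).lin z)
      (h := fun i => (s i).lin x) (fun i => (hz0 i).le) hall
    rw [Finset.sum_eq_single i]
    · exact if_pos ⟨hi, hmin⟩
    · intro k _ hki
      refine if_neg fun h => hD i k hki.symm (hx i) (le_antisymm ?_ (hmin k))
      have h1 := h.2 i
      rw [hanti i k] at h1
      exact neg_nonneg.1 h1
    · simp

/-! ### Passing between the plane and the projective model -/

/-- The projective coordinates of a point of the plane. -/
def klein (x : Plane) : ℝ × ℝ := (x 0 ^ 2 + x 1 ^ 2, x 1)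

/-- The point of the plane over `q` whose `x₀`-coordinate is `σ √(r - v²)`. -/
noncomputable def planeLift (σ : ℝ) (q : ℝ × ℝ) : Plane := !₂[σ * √(q.1 - q.2 ^ 2), q.2]

theorem klein_mem {x : Plane} (hx : x 0 ≠ 0) : klein x ∈ kleinDomain := by
  change x 1 ^ 2 < x 0 ^ 2 + x 1 ^ 2
  have : 0 < x 0 ^ 2 := by positivity
  linarith

theorem klein_planeLift {σ : ℝ} (hσ : σ ^ 2 = 1) {q : ℝ × ℝ} (hq : q ∈ kleinDomain) :
    klein (planeLift σ q) = q := by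
  have hq : q.2 ^ 2 < q.1 := hq
  ext
  · simp [klein, planeLift, mul_pow, hσ, Real.sq_sqrt (sub_nonneg.2 hq.le)]
  · simp [klein, planeLift]

theorem planeLift_one_pos {q : ℝ × ℝ} (hq : q ∈ kleinDomain) : 0 < planeLift 1 q 0 := by
  have hq : q.2 ^ 2 < q.1 := hq
  simp [planeLift, hq]

theorem planeLift_klein {x : Plane} {σ : ℝ} (hσ : σ * |x 0| = x 0) :
    planeLift σ (klein x) = x := by
  ext i
  fin_cases i <;> simp [klein, planeLift, Real.sqrt_sq_eq_abs, hσ]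

theorem continuous_planeLift (σ : ℝ) : Continuous (planeLift σ) := by
  unfold planeLift
  refine (PiLp.continuous_toLp 2 _).comp (continuous_pi fun i => ?_)
  fin_cases i
  · simp only [Fin.zero_eta, Matrix.cons_val_zero]
    fun_prop
  · simp only [Fin.mk_one, Matrix.cons_val_one, Matrix.cons_val_fin_one]
    fun_prop

theorem klein_injOn {x y : Plane} (hx : 0 < x 0) (hy : 0 < y 0) (h : klein x = klein y) :
    x = y := by
  rw [← planeLift_klein (x := x) (σ := 1) (by simp [abs_of_pos hx]), h,
    planeLift_klein (by simp [abs_of_pos hy])]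

namespace HalfSpace

theorem eval_eq_lin (H : HalfSpace) (x : Plane) : H.eval x = H.lin (klein x) := rfl

theorem coe_mem_carrier {H : HalfSpace} {x : Plane} : (x : DH2) ∈ H.carrier ↔ 0 ≤ H.eval x := by
  simp [carrier, OnePoint.coe_ne_infty]

end HalfSpace

/-! ### The projective region of a finite family of half-spaces -/

/-- The part of the upper sheet cut out by `F`. -/
def kleinRegion (F : Set HalfSpace) : Set (ℝ × ℝ) := {q ∈ kleinDomain | ∀ H ∈ F, 0 ≤ H.lin q}

theorem isOpen_kleinDomain_inter_pos {F : Set HalfSpace} (hF : F.Finite) :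
    IsOpen {q ∈ kleinDomain | ∀ H ∈ F, 0 < H.lin q} := by
  have : {q ∈ kleinDomain | ∀ H ∈ F, 0 < H.lin q}
      = kleinDomain ∩ ⋂ H ∈ F, {q | 0 < H.lin q} := by
    ext; simp
  rw [this]
  exact isOpen_kleinDomain.inter
    (hF.isOpen_biInter fun H _ => isOpen_lt continuous_const H.continuous_lin)

theorem eventually_shift_mem {U : Set (ℝ × ℝ)} (hU : IsOpen U) {y : ℝ × ℝ} (hy : y ∈ U) (a b : ℝ) :
    ∃ t : ℝ, 0 < t ∧ (y.1 + t * a, y.2 + t * b) ∈ U := by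
  have hc : ContinuousAt (fun t : ℝ => (y.1 + t * a, y.2 + t * b)) 0 := by fun_prop
  have h := (hc.eventually (p := (· ∈ U)) (by simpa using hU.mem_nhds hy)).filter_mono
    (nhdsWithin_le_nhds (s := Set.Ioi 0))
  obtain ⟨t, ht, ht0⟩ := (h.and self_mem_nhdsWithin).exists
  exact ⟨t, ht0, ht⟩

/-- If `K` vanished at the interior point y, a small step against its gradient would stay in the
region and make it negative. -/
theorem lin_pos_of_nonneg_on_region {F : Set HalfSpace} (hF : F.Finite) {y : ℝ × ℝ}
    (hy : y ∈ kleinDomain) (hpos : ∀ H ∈ F, 0 < H.lin y) {K : HalfSpace}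
    (hK : ∀ q ∈ kleinRegion F, 0 ≤ K.lin q) : 0 < K.lin y := by
  have h0 := hK y ⟨hy, fun H hH => (hpos H hH).le⟩
  refine lt_of_le_of_ne h0 fun h => ?_
  obtain ⟨t, ht, hmem⟩ := eventually_shift_mem (isOpen_kleinDomain_inter_pos hF)
    (y := y) ⟨hy, hpos⟩ (-K.a) (-K.b)
  have h1 := hK _ ⟨hmem.1, fun H hH => (hmem.2 H hH).le⟩
  have h2 : K.lin (y.1 + t * -K.a, y.2 + t * -K.b) = -(t * (K.a ^ 2 + K.b ^ 2)) := by
    simp only [HalfSpace.lin] at h ⊢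
    linear_combination -h
  rw [h2] at h1
  have := mul_pos ht K.sq_add_sq_pos
  linarith

/-! ### The sides of a polytope as its irredundant defining half-spaces. -/

section Polytope

variable {P : Set DH2} {F : Set HalfSpace}

theorem coe_mem_iff (hPF : P = ⋂ H ∈ F, H.carrier) {x : Plane} :
    (x : DH2) ∈ P ↔ ∀ H ∈ F, 0 ≤ H.eval x := by
  simp [hPF, HalfSpace.coe_mem_carrier]

theorem klein_mem_region (hPF : P = ⋂ H ∈ F, H.carrier) {x : Plane} (hx : x ∈ upperPart P) :
    klein x ∈ kleinRegion F :=
  ⟨klein_mem hx.1.ne', fun H hH => (coe_mem_iff hPF).1 hx.2 H hH⟩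

theorem planeLift_mem_upperPart (hPF : P = ⋂ H ∈ F, H.carrier) {q : ℝ × ℝ}
    (hq : q ∈ kleinRegion F) : planeLift 1 q ∈ upperPart P := by
  refine ⟨planeLift_one_pos hq.1, (coe_mem_iff hPF).2 fun H hH => ?_⟩
  rw [H.eval_eq_lin, klein_planeLift (one_pow 2) hq.1]
  exact hq.2 H hH

/-- The interior point may lie in the lower sheet. The half-spaces are symmetric under x₀ ↦ -x₀, so
it suffices to move off x₀ = 0, pass to projective coordinates, and avoid the boundary lines. -/
theorem exists_interior_center (hF : F.Finite) (hPF : P = ⋂ H ∈ F, H.carrier)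
    (hdim : (interior P).Nonempty) (hinf : (OnePoint.infty : DH2) ∉ P) :
    ∃ y ∈ kleinDomain, ∀ H ∈ F, 0 < H.lin y := by
  set V : Set Plane := (fun x : Plane => (x : DH2)) ⁻¹' interior P with hV
  have hVo : IsOpen V := isOpen_interior.preimage OnePoint.continuous_coe
  obtain ⟨x, hx⟩ : V.Nonempty := by
    obtain ⟨p, hp⟩ := hdim
    induction p using OnePoint.rec with
    | infty => exact absurd (interior_subset hp) hinf
    | coe x => exact ⟨x, hp⟩
  obtain ⟨x, hx, hx0⟩ : ∃ x ∈ V, x 0 ≠ 0 := by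
    by_cases h0 : x 0 = 0
    swap
    · exact ⟨x, hx, h0⟩
    have hc : ContinuousAt (fun t : ℝ => x + t • (EuclideanSpace.single 0 1 : Plane)) 0 := by
      fun_prop
    have h := (hc.eventually (p := (· ∈ V)) (by simpa using hVo.mem_nhds hx)).filter_mono
      (nhdsWithin_le_nhds (s := Set.Ioi 0))
    obtain ⟨t, ht, ht0⟩ := (h.and self_mem_nhdsWithin).exists
    refine ⟨_, ht, ?_⟩
    have ht0 : 0 < t := ht0
    simp [h0, ht0.ne']
  obtain ⟨σ, hσ, hσx⟩ : ∃ σ : ℝ, σ ^ 2 = 1 ∧ σ * |x 0| = x 0 := by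
    rcases lt_or_gt_of_ne hx0 with h | h
    · exact ⟨-1, by norm_num, by rw [abs_of_neg h]; ring⟩
    · exact ⟨1, by norm_num, by rw [abs_of_pos h]; ring⟩
  have hWo : IsOpen (kleinDomain ∩ planeLift σ ⁻¹' V) :=
    isOpen_kleinDomain.inter (hVo.preimage (continuous_planeLift σ))
  have : Finite F := hF
  obtain ⟨q, ⟨hq, hqV⟩, hq0⟩ := exists_mem_forall_affine_ne_zero (ι := F) hWo (y := klein x)
    ⟨klein_mem hx0, by rwa [Set.mem_preimage, planeLift_klein hσx]⟩
    (fun H => H.1.a) (fun H => H.1.b) (fun H => H.1.c) fun H => by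
      by_contra! h
      have := H.1.unit_normal
      simp [h.1, h.2.1] at this
  refine ⟨q, hq, fun H hH => lt_of_le_of_ne ?_ (hq0 ⟨H, hH⟩).symm⟩
  have := (coe_mem_iff hPF).1 (interior_subset hqV) H hH
  rwa [H.eval_eq_lin, klein_planeLift hσ hq] at this

theorem lin_nonneg_of_mem_sides (hPF : P = ⋂ H ∈ F, H.carrier) {H : HalfSpace} (hH : H ∈ sides P)
    {q : ℝ × ℝ} (hq : q ∈ kleinRegion F) : 0 ≤ H.lin q := by
  have := HalfSpace.coe_mem_carrier.1 (hH.1 (planeLift_mem_upperPart hPF hq).2)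
  rwa [H.eval_eq_lin, klein_planeLift (one_pow 2) hq.1] at this

/-- Every side has a relatively interior point. -/
theorem exists_rel_interior_point (hF : F.Finite) (hPF : P = ⋂ H ∈ F, H.carrier) {y : ℝ × ℝ}
    (hy : y ∈ kleinDomain) (hpos : ∀ H ∈ F, 0 < H.lin y) {H : HalfSpace} (hH : H ∈ sides P) :
    ∃ p ∈ kleinDomain, H.lin p = 0 ∧
      ∀ K : HalfSpace, (∀ q ∈ kleinRegion F, 0 ≤ K.lin q) → K ≠ H → 0 < K.lin p := by
  obtain ⟨u, hu, w, hw, huw⟩ := hH.2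
  have hu' := klein_mem_region hPF hu.1
  have hw' := klein_mem_region hPF hw.1
  have hne : klein u ≠ klein w := fun h => huw (klein_injOn hu.1.1 hw.1.1 h)
  have hu0 : H.lin (klein u) = 0 := hu.2
  have hw0 : H.lin (klein w) = 0 := hw.2
  have half : (1 / 2 : ℝ) + 1 / 2 = 1 := by norm_num
  -- The midpoint of two points of the side works: a nonnegative functional vanishing there vanishes
  -- at both ends, hence defines the same half-space.
  refine ⟨_, segment_mem_kleinDomain (s := 1 / 2) (t := 1 / 2) hu'.1 hw'.1 (by norm_num)
    (by norm_num) half, ?_, fun K hK hKH => ?_⟩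
  · rw [H.lin_segment _ _ half, hu0, hw0]
    simp
  · rw [K.lin_segment _ _ half]
    have h1 := hK _ hu'
    have h2 := hK _ hw'
    by_contra! h
    exact hKH (HalfSpace.eq_of_vanish hne (by linarith) (by linarith) hu0 hw0
      (lin_pos_of_nonneg_on_region hF hy hpos hK)
      (lin_pos_of_nonneg_on_region hF hy hpos fun q hq => lin_nonneg_of_mem_sides hPF hH hq))

/-- Were a side not in `F`, its relative interior point would be strictly inside every member of
`F`, so the side's functional could not vanish there. -/
theorem sides_subset (hF : F.Finite) (hPF : P = ⋂ H ∈ F, H.carrier) {y : ℝ × ℝ}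
    (hy : y ∈ kleinDomain) (hpos : ∀ H ∈ F, 0 < H.lin y) : sides P ⊆ F := by
  intro H hH
  by_contra hHF
  obtain ⟨p, hp, hp0, hpK⟩ := exists_rel_interior_point hF hPF hy hpos hH
  have := lin_pos_of_nonneg_on_region hF hp
    (fun K hK => hpK K (fun q hq => hq.2 K hK) (by rintro rfl; exact hHF hK))
    (fun q hq => lin_nonneg_of_mem_sides hPF hH hq)
  linarith

/-- A point of the upper sheet outside `P` lies beyond some side. -/
theorem exists_side_of_notMem (hF : F.Finite) (hPF : P = ⋂ H ∈ F, H.carrier) {y : ℝ × ℝ}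
    (hy : y ∈ kleinDomain) (hpos : ∀ H ∈ F, 0 < H.lin y) {x : ℝ × ℝ} (hx : x ∈ kleinDomain)
    (hxF : x ∉ kleinRegion F) : ∃ H ∈ sides P, H.lin x < 0 := by
  have : Finite F := hF
  obtain ⟨z, hz, hzpos, hD⟩ := exists_generic_center (s := fun H : F => H.1)
    Subtype.val_injective hy (fun H => hpos _ H.2) x
  obtain ⟨⟨H, hH⟩, hHx, hmin⟩ := exists_first_exit (ι := F) (g := fun H => H.1.lin z)
    (h := fun H => H.1.lin x) (fun H => (hzpos H).le) (by
      by_contra! h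
      exact hxF ⟨hx, fun H hH => h ⟨H, hH⟩⟩)
  have hHx : H.lin x < 0 := hHx
  have hlt : H.lin x < H.lin z := hHx.trans (hzpos ⟨H, hH⟩)
  set e := H.crossing z x with he
  have hed : e ∈ kleinDomain := HalfSpace.crossing_mem hz hx (hzpos ⟨H, hH⟩).le hHx
  have heH : H.lin e = 0 := by
    rw [he, HalfSpace.lin_crossing _ _ hlt]
    simp [mul_comm]
  have heK : ∀ K ∈ F \ {H}, 0 < K.lin e := by
    rintro K ⟨hK, hKH⟩
    rw [he, HalfSpace.lin_crossing _ _ hlt]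
    exact div_pos (lt_of_le_of_ne (hmin ⟨K, hK⟩) (hD ⟨H, hH⟩ ⟨K, hK⟩ (fun h => hKH (congrArg Subtype.val h).symm) hHx.ne).symm)
      (by linarith)
  have hmem : ∀ q ∈ kleinDomain, H.lin q = 0 → (∀ K ∈ F \ {H}, 0 < K.lin q) →
      planeLift 1 q ∈ sideOn P H := by
    intro q hq hqH hqK
    refine ⟨planeLift_mem_upperPart hPF ⟨hq, fun K hK => ?_⟩, ?_⟩
    · by_cases h : K = H
      · rw [h, hqH]
      · exact (hqK K ⟨hK, h⟩).le
    · rw [H.eval_eq_lin, klein_planeLift (one_pow 2) hq, hqH]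
  -- At the generic first exit point only `H` is active, so sliding along its line in direction (b,
  -- -a) gives a second point of the side.
  obtain ⟨t, ht, htm⟩ := eventually_shift_mem
    (isOpen_kleinDomain_inter_pos (hF.subset (Set.sdiff_subset (t := {H})))) ⟨hed, heK⟩ H.b (-H.a)
  refine ⟨H, ⟨?_, planeLift 1 e, hmem e hed heH heK, _, hmem _ htm.1 ?_ htm.2, fun h => ?_⟩, hHx⟩
  · rw [hPF]
    exact Set.biInter_subset_of_mem hH
  · rw [← heH]
    simp only [HalfSpace.lin]
    ring
  · have h := congrArg klein h
    rw [klein_planeLift (one_pow 2) hed, klein_planeLift (one_pow 2) htm.1, Prod.ext_iff] at h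
    have hn := H.sq_add_sq_pos
    have hb : H.b = 0 := by
      have := h.1
      simp only [left_eq_add, mul_eq_zero] at this
      exact this.resolve_left ht.ne'
    have ha : H.a = 0 := by
      have := h.2
      simp only [left_eq_add, mul_eq_zero, neg_eq_zero] at this
      exact this.resolve_left ht.ne'
    simp [ha, hb] at hn

theorem mem_kleinRegion_iff (hF : F.Finite) (hPF : P = ⋂ H ∈ F, H.carrier) {y : ℝ × ℝ}
    (hy : y ∈ kleinDomain) (hpos : ∀ H ∈ F, 0 < H.lin y) {m : ℕ} {s : Fin m → HalfSpace}
    (hs : Set.range s = sides P) {x : ℝ × ℝ} (hx : x ∈ kleinDomain) :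
    x ∈ kleinRegion F ↔ ∀ i, 0 ≤ (s i).lin x := by
  constructor
  · exact fun h i => lin_nonneg_of_mem_sides hPF (hs ▸ Set.mem_range_self i) h
  · intro h
    by_contra hxF
    obtain ⟨H, hH, hHx⟩ := exists_side_of_notMem hF hPF hy hpos hx hxF
    rw [← hs] at hH
    obtain ⟨i, rfl⟩ := hH
    exact (h i).not_gt hHx

theorem meets_iff (hF : F.Finite) (hPF : P = ⋂ H ∈ F, H.carrier) {y : ℝ × ℝ}
    (hy : y ∈ kleinDomain) (hpos : ∀ H ∈ F, 0 < H.lin y) {m : ℕ} {s : Fin m → HalfSpace}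
    (hs : Set.range s = sides P) (i j : Fin m) :
    Meets s i j ↔ (sideOn P (s i) ∩ sideOn P (s j)).Nonempty := by
  constructor
  · rintro ⟨q, hq, hq0, hqi, hqj⟩
    have hqF := (mem_kleinRegion_iff hF hPF hy hpos hs hq).2 hq0
    have hP := planeLift_mem_upperPart hPF hqF
    refine ⟨planeLift 1 q, ⟨hP, ?_⟩, hP, ?_⟩ <;>
      rw [HalfSpace.eval_eq_lin, klein_planeLift (one_pow 2) hq] <;> assumption
  · rintro ⟨x, hxi, hxj⟩
    have hx := klein_mem_region hPF hxi.1
    exact ⟨klein x, hx.1, (mem_kleinRegion_iff hF hPF hy hpos hs hx.1).1 hx, hxi.2, hxj.2⟩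

end Polytope

/-! ### Reduction to iterated integrals -/

/-- The section at height `v` of the intersection of the half-spaces in `F`. -/
def polySection (F : Set HalfSpace) (v : ℝ) : Set ℝ :=
  {x | ∀ H ∈ F, 0 ≤ H.a * (x ^ 2 + v ^ 2) + H.b * v + H.c}

theorem measurableSet_polySection (F : Set HalfSpace) (v : ℝ) :
    MeasurableSet (polySection F v) := by
  have : polySection F v = ⋂ H ∈ F, {x | 0 ≤ H.a * (x ^ 2 + v ^ 2) + H.b * v + H.c} := by
    ext; simp [polySection]
  rw [this]
  exact (isClosed_biInter fun H _ => isClosed_le continuous_const (by fun_prop)).measurableSet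

/-- The coordinates of the plane as a measurable equivalence with `ℝ × ℝ`. -/
def planeCoords : Plane ≃ᵐ ℝ × ℝ :=
  (MeasurableEquiv.toLp 2 (Fin 2 → ℝ)).symm.trans MeasurableEquiv.finTwoArrow

theorem measurePreserving_planeCoords : MeasurePreserving planeCoords volume volume :=
  (PiLp.volume_preserving_ofLp (Fin 2)).trans (volume_preserving_finTwoArrow ℝ)

/-- The half-space with a < 0 is a disc, so P is compact in the plane and Fubini applies. -/
theorem muEps_eq_integral_sectionIntegral {P : Set DH2} {F : Set HalfSpace}
    (hPF : P = ⋂ H ∈ F, H.carrier) {H₀ : HalfSpace} (hH₀ : H₀ ∈ F) (ha : H₀.a < 0) {ε : ℝ}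
    (hε : 0 < ε) : muEps ε P = ∫ v, sectionIntegral ε (polySection F v) := by
  have hset : {x : Plane | (x : DH2) ∈ P} = ⋂ H ∈ F, {x : Plane | 0 ≤ H.eval x} := by
    ext x
    rw [Set.mem_ofPred_eq, coe_mem_iff hPF]
    simp
  have hclosed : IsClosed {x : Plane | (x : DH2) ∈ P} := by
    rw [hset]
    refine isClosed_biInter fun H _ => isClosed_le continuous_const ?_
    unfold HalfSpace.eval
    fun_prop
  have hbdd : Bornology.IsBounded {x : Plane | (x : DH2) ∈ P} := by
    refine (Metric.isBounded_closedBall (x := (!₂[0, -H₀.b / (2 * H₀.a)] : Plane))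
      (r := 1 / (2 * -H₀.a))).subset fun x hx => ?_
    have hx := (coe_mem_iff hPF).1 hx H₀ hH₀
    have h1 : x 0 ^ 2 + (x 1 - -H₀.b / (2 * H₀.a)) ^ 2 ≤ (1 / (2 * -H₀.a)) ^ 2 := by
      have e : x 0 ^ 2 + (x 1 - -H₀.b / (2 * H₀.a)) ^ 2 - (1 / (2 * -H₀.a)) ^ 2
          = H₀.eval x / H₀.a := by
        have ha' := ha.ne
        rw [HalfSpace.eval]
        field_simp
        linear_combination H₀.unit_normal
      have := div_nonpos_of_nonneg_of_nonpos hx ha.le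
      linarith
    rw [Metric.mem_closedBall, EuclideanSpace.dist_eq, Fin.sum_univ_two]
    refine Real.sqrt_le_iff.2 ⟨div_nonneg zero_le_one (by linarith), ?_⟩
    simpa [Real.dist_eq, sq_abs] using h1
  set g : ℝ × ℝ → ℂ := {p : ℝ × ℝ | p.1 ∈ polySection F p.2}.indicator fun p => muKernel ε p.1
    with hg
  have hgc : ∀ x : Plane, g (planeCoords x)
      = {x : Plane | (x : DH2) ∈ P}.indicator (fun x => muKernel ε (x 0)) x := by
    intro x
    have : planeCoords x ∈ {p : ℝ × ℝ | p.1 ∈ polySection F p.2} ↔ (x : DH2) ∈ P :=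
      (coe_mem_iff hPF).symm
    by_cases h : (x : DH2) ∈ P
    · rw [hg, Set.indicator_of_mem (this.2 h), Set.indicator_of_mem (by exact h)]
      rfl
    · rw [hg, Set.indicator_of_notMem (fun h' => h (this.1 h')),
        Set.indicator_of_notMem (by exact h)]
  have hint : Integrable g volume := by
    rw [← measurePreserving_planeCoords.integrable_comp_emb planeCoords.measurableEmbedding]
    have : g ∘ planeCoords = {x : Plane | (x : DH2) ∈ P}.indicator fun x => muKernel ε (x 0) :=
      funext hgc
    rw [this, integrable_indicator_iff hclosed.measurableSet]
    refine ContinuousOn.integrableOn_compact (Metric.isCompact_of_isClosed_isBounded hclosed hbdd)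
      ((continuous_muKernel hε).comp ?_).continuousOn
    fun_prop
  have h1 : muEps ε P = ∫ x : Plane, g (planeCoords x) := by
    simp_rw [hgc]
    rw [integral_indicator hclosed.measurableSet]
    rfl
  rw [h1, measurePreserving_planeCoords.integral_comp planeCoords.measurableEmbedding g]
  rw [Measure.volume_eq_prod] at hint ⊢
  rw [integral_prod_symm _ hint]
  refine integral_congr_ae (ae_of_all _ fun v => ?_)
  change ∫ x, g (x, v) = ∫ x in polySection F v, muKernel ε x
  rw [← integral_indicator (measurableSet_polySection F v)]
  rfl

theorem sectionIntegral_eq_integral {A : Set ℝ} (hA : MeasurableSet A) (ε : ℝ) :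
    sectionIntegral ε A = ∫ x, A.indicator (muKernel ε) x := (integral_indicator hA).symm

open scoped Classical in
/-- The section of the wedge of two sides that meet, and the empty set for other sides. -/
noncomputable def pairSection {m : ℕ} (s : Fin m → HalfSpace) (i j : Fin m) (v : ℝ) : Set ℝ :=
  if Meets s i j then (s i).wedge (s j) v else ∅

theorem measurableSet_pairSection {m : ℕ} (s : Fin m → HalfSpace) (i j : Fin m) (v : ℝ) :
    MeasurableSet (pairSection s i j v) := by
  unfold pairSection
  split_ifs
  · exact (((s i).isOpen_outside v).inter ((s j).isOpen_outside v)).measurableSet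
  · exact MeasurableSet.empty

/-! ### The visibility identity integrated over sections. -/

section Sections

variable {m : ℕ} {s : Fin m → HalfSpace}

theorem sectionIntegral_polySection {F : Set HalfSpace}
    (hs : Function.Injective s) {y : ℝ × ℝ} (hy : y ∈ kleinDomain) (hpos : ∀ i, 0 < (s i).lin y)
    (hm : ∀ i, ∃ p ∈ kleinDomain, (s i).lin p = 0 ∧ ∀ j, j ≠ i → 0 < (s j).lin p)
    (hreg : ∀ x ∈ kleinDomain, x ∈ kleinRegion F ↔ ∀ i, 0 ≤ (s i).lin x) {ε : ℝ} (hε : 0 < ε) :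
    ∀ᵐ v, sectionIntegral ε (polySection F v)
      = (∑ i, ∑ j ∈ Finset.Ioi i, sectionIntegral ε (pairSection s i j v))
        - ∑ i, sectionIntegral ε ((s i).outside v) := by
  classical
  have hall : ∀ᵐ v : ℝ, ∀ i, ∀ᵐ x : ℝ,
      (s i).a * (x ^ 2 + v ^ 2) + (s i).b * v + (s i).c ≠ 0 :=
    ae_all_iff.2 fun i => (s i).ae_ae_ne_zero
  filter_upwards [hall] with v hv
  have hk := integrable_muKernel hε
  have ho := fun i => ((s i).isOpen_outside v).measurableSet
  have hp := fun i j => measurableSet_pairSection s i j v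
  have hpoint : (polySection F v).indicator (muKernel ε) =ᵐ[volume] fun x =>
      muKernel ε x + ((∑ i, ∑ j ∈ Finset.Ioi i, (pairSection s i j v).indicator (muKernel ε) x)
        - ∑ i, ((s i).outside v).indicator (muKernel ε) x) := by
    filter_upwards [ae_all_iff.2 hv, measure_eq_zero_iff_ae_notMem.1
      ((Set.finite_singleton (0 : ℝ)).measure_zero volume)] with x hx hx0
    have hx0 : x ≠ 0 := hx0
    have hxd : (x ^ 2 + v ^ 2, v) ∈ kleinDomain := by
      change v ^ 2 < x ^ 2 + v ^ 2
      have : 0 < x ^ 2 := by positivity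
      linarith
    have hid := visible_sides_sub_visible_pairs hs hy hpos hm hxd hx
    have hP : x ∈ polySection F v ↔ ∀ i, 0 ≤ (s i).lin (x ^ 2 + v ^ 2, v) := by
      rw [← hreg _ hxd]
      exact ⟨fun h => ⟨hxd, h⟩, fun h => h.2⟩
    have e1 : (polySection F v).indicator (muKernel ε) x
        = (1 - ((if ∀ i, 0 ≤ (s i).lin (x ^ 2 + v ^ 2, v) then 0 else 1 : ℝ) : ℂ))
          * muKernel ε x := by
      rw [Set.indicator_apply, ← if_congr hP rfl rfl]
      split_ifs <;> simp
    have e2 : ∀ i, ((s i).outside v).indicator (muKernel ε) x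
        = ((if (s i).lin (x ^ 2 + v ^ 2, v) < 0 then 1 else 0 : ℝ) : ℂ) * muKernel ε x := by
      intro i
      have : x ∈ (s i).outside v ↔ (s i).lin (x ^ 2 + v ^ 2, v) < 0 := Iff.rfl
      rw [Set.indicator_apply, ← if_congr this rfl rfl]
      split_ifs <;> simp
    have e3 : ∀ i j, (pairSection s i j v).indicator (muKernel ε) x
        = ((if Meets s i j ∧ (s i).lin (x ^ 2 + v ^ 2, v) < 0 ∧ (s j).lin (x ^ 2 + v ^ 2, v) < 0
            then 1 else 0 : ℝ) : ℂ) * muKernel ε x := by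
      intro i j
      have : x ∈ pairSection s i j v ↔ Meets s i j ∧ (s i).lin (x ^ 2 + v ^ 2, v) < 0
          ∧ (s j).lin (x ^ 2 + v ^ 2, v) < 0 := by
        unfold pairSection
        split_ifs with h
        · exact ⟨fun h' => ⟨h, h'⟩, fun h' => h'.2⟩
        · exact ⟨fun h' => h'.elim, fun h' => (h h'.1).elim⟩
      rw [Set.indicator_apply, ← if_congr this rfl rfl]
      split_ifs <;> simp
    simp_rw [e1, e2, e3, ← Finset.sum_mul, ← hid]
    push_cast
    ring
  rw [sectionIntegral_eq_integral (measurableSet_polySection F v), integral_congr_ae hpoint]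
  have hi1 : ∀ i, Integrable (((s i).outside v).indicator (muKernel ε)) :=
    fun i => hk.indicator (ho i)
  have hi2 : ∀ i j, Integrable ((pairSection s i j v).indicator (muKernel ε)) :=
    fun i j => hk.indicator (hp i j)
  have hi3 : ∀ i, Integrable fun x =>
      ∑ j ∈ Finset.Ioi i, (pairSection s i j v).indicator (muKernel ε) x :=
    fun i => integrable_finsetSum _ fun j _ => hi2 i j
  have hz : ∫ x, muKernel ε x = 0 := by
    rw [← setIntegral_univ]
    exact sectionIntegral_univ hε
  have hi4 : Integrable fun x =>
      ∑ i, ∑ j ∈ Finset.Ioi i, (pairSection s i j v).indicator (muKernel ε) x :=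
    integrable_finsetSum _ fun i _ => hi3 i
  have hi5 : Integrable fun x => ∑ i, ((s i).outside v).indicator (muKernel ε) x :=
    integrable_finsetSum _ fun i _ => hi1 i
  have hi6 : Integrable fun x =>
      (∑ i, ∑ j ∈ Finset.Ioi i, (pairSection s i j v).indicator (muKernel ε) x)
        - ∑ i, ((s i).outside v).indicator (muKernel ε) x := hi4.sub hi5
  rw [integral_add hk hi6, integral_sub hi4 hi5, integral_finsetSum _ fun i _ => hi3 i,
    integral_finsetSum _ fun i _ => hi1 i, hz, zero_add]
  congr 1
  · refine Finset.sum_congr rfl fun i _ => ?_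
    rw [integral_finsetSum _ fun j _ => hi2 i j]
    exact Finset.sum_congr rfl fun j _ => (sectionIntegral_eq_integral (hp i j) ε).symm
  · exact Finset.sum_congr rfl fun i _ => (sectionIntegral_eq_integral (ho i) ε).symm

/-! ### Counting at the point at infinity -/

/-- The points tested lie over (1, T) and (1, -T), which approach infinity from two directions. The
sign of a decides visibility; when a = 0 exactly one of the two points sees the side. -/
theorem HalfSpace.eventually_visible (H : HalfSpace) : ∀ᶠ T : ℝ in atTop,
    H.lin (1 + T ^ 2, T) ≠ 0 ∧ H.lin (1 + (-T) ^ 2, -T) ≠ 0 ∧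
    (0 < H.a → 0 < H.lin (1 + T ^ 2, T) ∧ 0 < H.lin (1 + (-T) ^ 2, -T)) ∧
    (H.a < 0 → H.lin (1 + T ^ 2, T) < 0 ∧ H.lin (1 + (-T) ^ 2, -T) < 0) ∧
    (H.a = 0 → (H.lin (1 + T ^ 2, T) < 0 ∧ 0 < H.lin (1 + (-T) ^ 2, -T)) ∨
      (0 < H.lin (1 + T ^ 2, T) ∧ H.lin (1 + (-T) ^ 2, -T) < 0)) := by
  by_cases ha : H.a = 0
  · have hb : H.b = 1 ∨ H.b = -1 := by
      have := H.unit_normal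
      simpa [ha] using this
    filter_upwards [eventually_gt_atTop |H.c|] with T hT
    have := abs_lt.1 hT
    simp only [HalfSpace.lin, ha]
    rcases hb with hb | hb <;> rw [hb]
    · have h1 : 0 < 0 * (1 + T ^ 2) + 1 * T + H.c := by linarith
      have h2 : 0 * (1 + (-T) ^ 2) + 1 * -T + H.c < 0 := by linarith
      exact ⟨h1.ne', h2.ne, by simp, by simp, fun _ => Or.inr ⟨h1, h2⟩⟩
    · have h1 : 0 * (1 + T ^ 2) + -1 * T + H.c < 0 := by linarith
      have h2 : 0 < 0 * (1 + (-T) ^ 2) + -1 * -T + H.c := by linarith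
      exact ⟨h1.ne, h2.ne', by simp, by simp, fun _ => Or.inl ⟨h1, h2⟩⟩
  · have ha' : 0 < |H.a| := abs_pos.2 ha
    filter_upwards [eventually_gt_atTop ((|H.b| + |H.c|) / |H.a|), eventually_ge_atTop 1]
      with T hT hT1
    rw [div_lt_iff₀ ha'] at hT
    have key : |H.b| * T + |H.c| < |H.a| * (1 + T ^ 2) := by
      nlinarith [mul_lt_mul_of_pos_right hT (show 0 < T by linarith), abs_nonneg H.c,
        mul_nonneg (abs_nonneg H.c) (sub_nonneg.2 hT1)]
    have hb1 : |H.b * T| = |H.b| * T := by rw [abs_mul, abs_of_pos (by linarith : 0 < T)]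
    have hb2 := abs_le.1 hb1.le
    have hc := abs_le.1 (le_refl |H.c|)
    rw [HalfSpace.lin, HalfSpace.lin]
    simp only [neg_sq]
    rcases lt_or_gt_of_ne ha with h | h
    · rw [abs_of_neg h] at key
      have h1 : H.a * (1 + T ^ 2) + H.b * T + H.c < 0 := by linarith
      have h2 : H.a * (1 + T ^ 2) + H.b * -T + H.c < 0 := by linarith
      exact ⟨h1.ne, h2.ne, fun h' => absurd h' h.le.not_gt, fun _ => ⟨h1, h2⟩,
        fun h' => absurd h' ha⟩
    · rw [abs_of_pos h] at key
      have h1 : 0 < H.a * (1 + T ^ 2) + H.b * T + H.c := by linarith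
      have h2 : 0 < H.a * (1 + T ^ 2) + H.b * -T + H.c := by linarith
      exact ⟨h1.ne', h2.ne', fun _ => ⟨h1, h2⟩, fun h' => absurd h' h.le.not_gt,
        fun h' => absurd h' ha⟩

/-- Two boundary lines perpendicular to x₀ = 0 are parallel, so those of distinct sides have no
common point. -/
theorem Meets.a_ne_zero (hs : Function.Injective s) {y : ℝ × ℝ} (hpos : ∀ i, 0 < (s i).lin y)
    {i j : Fin m} (hij : i ≠ j) (h : Meets s i j) : (s i).a ≠ 0 ∨ (s j).a ≠ 0 := by
  by_contra! h0
  obtain ⟨q, -, -, hi, hj⟩ := h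
  refine hij (hs (HalfSpace.eq_of_vanish (p := q) (q := (q.1 + 1, q.2)) ?_ hi ?_ hj ?_
    (hpos i) (hpos j)))
  · intro h
    simpa using congrArg Prod.fst h
  · rw [← hi]
    simp [HalfSpace.lin, h0.1]
  · rw [← hj]
    simp [HalfSpace.lin, h0.2]

open scoped Classical in
/-- The count of visible sides and pairs at the point at infinity, where a half-space bounded by a
line counts by half. -/
theorem visible_count_infty {F : Set HalfSpace} (hs : Function.Injective s) {y : ℝ × ℝ}
    (hy : y ∈ kleinDomain) (hpos : ∀ i, 0 < (s i).lin y)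
    (hm : ∀ i, ∃ p ∈ kleinDomain, (s i).lin p = 0 ∧ ∀ j, j ≠ i → 0 < (s j).lin p)
    (hreg : ∀ x ∈ kleinDomain, x ∈ kleinRegion F ↔ ∀ i, 0 ≤ (s i).lin x)
    {H₀ : HalfSpace} (hH₀ : H₀ ∈ F) (ha : H₀.a < 0) :
    (∑ i, (1 - (SignType.sign (s i).a : ℝ)) / 2)
      - ∑ i, ∑ j ∈ Finset.Ioi i, (if Meets s i j then
        (1 - (SignType.sign (s i).a : ℝ)) * (1 - (SignType.sign (s j).a : ℝ)) / 4 else 0) = 1 := by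
  -- The result is the average of the visibility identity at the two far points, both outside P
  -- because of `H₀`.
  obtain ⟨T, hT, hT0⟩ := ((eventually_all.2 fun i => (s i).eventually_visible).and
    H₀.eventually_visible).exists
  have hd : ∀ t : ℝ, (1 + t ^ 2, t) ∈ kleinDomain := fun t => by
    change t ^ 2 < 1 + t ^ 2
    linarith
  have hout : ∀ t : ℝ, H₀.lin (1 + t ^ 2, t) < 0 → ¬ ∀ i, 0 ≤ (s i).lin (1 + t ^ 2, t) :=
    fun t ht h => ((hreg _ (hd t)).2 h |>.2 _ hH₀).not_gt ht
  have h1 := visible_sides_sub_visible_pairs hs hy hpos hm (hd T) fun i => (hT i).1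
  have h2 := visible_sides_sub_visible_pairs hs hy hpos hm (hd (-T)) fun i => (hT i).2.1
  obtain ⟨-, -, -, hneg0, -⟩ := hT0
  rw [if_neg (hout _ (hneg0 ha).1)] at h1
  rw [if_neg (hout _ (hneg0 ha).2)] at h2
  have e1 : ∀ i, (1 - (SignType.sign (s i).a : ℝ)) / 2
      = ((if (s i).lin (1 + T ^ 2, T) < 0 then (1 : ℝ) else 0)
        + if (s i).lin (1 + (-T) ^ 2, -T) < 0 then (1 : ℝ) else 0) / 2 := by
    intro i
    obtain ⟨-, -, hp, hn, hz⟩ := hT i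
    rcases lt_trichotomy (s i).a 0 with h | h | h
    · rw [if_pos (hn h).1, if_pos (hn h).2, sign_neg h]
      simp
    · rcases hz h with h' | h'
      · rw [if_pos h'.1, if_neg h'.2.le.not_gt, h]
        simp
      · rw [if_pos h'.2, if_neg h'.1.le.not_gt, h]
        simp
    · rw [if_neg (hp h).1.le.not_gt, if_neg (hp h).2.le.not_gt, sign_pos h]
      simp
  have e2 : ∀ i, ∀ j ∈ Finset.Ioi i, (if Meets s i j then
        (1 - (SignType.sign (s i).a : ℝ)) * (1 - (SignType.sign (s j).a : ℝ)) / 4 else 0)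
      = ((if Meets s i j ∧ (s i).lin (1 + T ^ 2, T) < 0 ∧ (s j).lin (1 + T ^ 2, T) < 0
          then (1 : ℝ) else 0)
        + if Meets s i j ∧ (s i).lin (1 + (-T) ^ 2, -T) < 0 ∧ (s j).lin (1 + (-T) ^ 2, -T) < 0
          then (1 : ℝ) else 0) / 2 := by
    intro i j hij
    by_cases hM : Meets s i j
    swap
    · simp [hM]
    have hne := hM.a_ne_zero hs hpos (Finset.mem_Ioi.1 hij).ne
    -- An average of products is not a product of averages in general; it is here because side k
    -- looks the same from both points.
    have hprod : ∀ k l, (s k).a ≠ 0 →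
        (1 - (SignType.sign (s k).a : ℝ)) * (1 - (SignType.sign (s l).a : ℝ)) / 4
        = ((if (s k).lin (1 + T ^ 2, T) < 0 ∧ (s l).lin (1 + T ^ 2, T) < 0
            then (1 : ℝ) else 0)
          + if (s k).lin (1 + (-T) ^ 2, -T) < 0 ∧ (s l).lin (1 + (-T) ^ 2, -T) < 0
            then (1 : ℝ) else 0) / 2 := by
      intro k l hk
      obtain ⟨-, -, hp, hn, -⟩ := hT k
      rcases lt_or_gt_of_ne hk with h | h
      · simp only [(hn h).1, (hn h).2, true_and]
        rw [← e1 l, sign_neg h]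
        simp
        ring
      · rw [if_neg fun h' => (hp h).1.not_gt h'.1, if_neg fun h' => (hp h).2.not_gt h'.1,
          sign_pos h]
        simp
    simp only [hM, true_and, if_true]
    rcases hne with h | h
    · exact hprod i j h
    · rw [mul_comm, hprod j i h]
      simp only [and_comm]
  rw [Finset.sum_congr rfl fun i _ => e1 i, Finset.sum_congr rfl fun i _ =>
    Finset.sum_congr rfl (e2 i)]
  simp only [← Finset.sum_div, Finset.sum_add_distrib]
  linarith

end Sections

/-! ### Assembly of the angle formula. -/

theorem wedgeMu_eq_dihedralAngle (H K : HalfSpace) (P : Set DH2)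
    (h : (sideOn P H ∩ sideOn P K).Nonempty) :
    H.wedgeMu K h.some = -2 * dihedralAngle P H K + 4 * Real.pi *
      ((1 - (SignType.sign H.a : ℝ)) * (1 - (SignType.sign K.a : ℝ)) / 4) := by
  rw [dihedralAngle, dif_pos h, HalfSpace.wedgeMu]
  ring

theorem mainTheorem8 (P : Set DH2) (hP : IsPolytope P) (hdim : (interior P).Nonempty)
    (hinf : (OnePoint.infty : DH2) ∉ P) :
    (sides P).Finite ∧
      ∀ (m : ℕ) (s : Fin m → HalfSpace), Function.Injective s → Set.range s = sides P →
        HasMu P ((2 * ((m : ℝ) - 2) * Real.pi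
          - 2 * ∑ i : Fin m, ∑ j ∈ Finset.Ioi i, dihedralAngle P (s i) (s j) : ℝ) : ℂ) := by
  classical
  obtain ⟨F, hF, hPF⟩ := hP
  obtain ⟨y, hy, hpos⟩ := exists_interior_center hF hPF hdim hinf
  have hsub := sides_subset hF hPF hy hpos
  refine ⟨hF.subset hsub, fun m s hs hrange => ?_⟩
  -- The point at infinity is excluded only by a half-space that is the inside of a circle.
  obtain ⟨H₀, hH₀, ha⟩ : ∃ H ∈ F, H.a < 0 := by
    by_contra! h
    refine hinf ?_
    rw [hPF]
    exact Set.mem_iInter₂.2 fun H hH => Or.inr ⟨rfl, h H hH⟩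
  have hside : ∀ i, s i ∈ sides P := fun i => hrange ▸ Set.mem_range_self i
  have hspos : ∀ i, 0 < (s i).lin y := fun i => hpos _ (hsub (hside i))
  have hm : ∀ i, ∃ p ∈ kleinDomain, (s i).lin p = 0 ∧ ∀ j, j ≠ i → 0 < (s j).lin p := by
    intro i
    obtain ⟨p, hp, hp0, hpK⟩ := exists_rel_interior_point hF hPF hy hpos (hside i)
    exact ⟨p, hp, hp0, fun j hj => hpK _ (fun q hq => lin_nonneg_of_mem_sides hPF (hside j) hq)
      (hs.ne hj)⟩
  have hreg := fun x (hx : x ∈ kleinDomain) => mem_kleinRegion_iff hF hPF hy hpos hrange hx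
  have hcount := visible_count_infty hs hy hspos hm hreg hH₀ ha
  set w : Fin m → Fin m → ℝ := fun i j => if Meets s i j then
    (1 - (SignType.sign (s i).a : ℝ)) * (1 - (SignType.sign (s j).a : ℝ)) / 4 else 0 with hw
  have hpair : ∀ i, ∀ j ∈ Finset.Ioi i, HasIteratedMu (pairSection s i j)
      (-2 * dihedralAngle P (s i) (s j) + 4 * Real.pi * w i j) := by
    intro i j hij
    by_cases hM : Meets s i j
    · have h := (meets_iff hF hPF hy hpos hrange i j).1 hM
      have hne : i ≠ j := (Finset.mem_Ioi.1 hij).ne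
      -- Opposite half-spaces cannot both be positive at y.
      have hopp : s i ≠ (s j).opp := fun h' => by
        have h1 := hspos i
        have h2 := hspos j
        rw [h'] at h1
        simp only [HalfSpace.lin, HalfSpace.opp] at h1 h2
        linarith
      have := HalfSpace.hasIteratedMu_wedge h.some_mem.1.1.1 h.some_mem.1.2 h.some_mem.2.2
        (hs.ne hne) hopp
      rw [wedgeMu_eq_dihedralAngle] at this
      convert this using 1
      · ext v
        rw [pairSection, if_pos hM]
      · simp [hw, hM]
    · have h : ¬ (sideOn P (s i) ∩ sideOn P (s j)).Nonempty := fun h =>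
        hM ((meets_iff hF hPF hy hpos hrange i j).2 h)
      convert HasIteratedMu.zero using 1
      · ext v
        rw [pairSection, if_neg hM]
      · rw [dihedralAngle, dif_neg h]
        simp [hw, hM]
  have hlim : Tendsto (fun ε =>
      (∑ i, ∑ j ∈ Finset.Ioi i, ∫ v, sectionIntegral ε (pairSection s i j v))
      - ∑ i, ∫ v, sectionIntegral ε ((s i).outside v)) (𝓝[>] 0)
      (𝓝 ((∑ i, ∑ j ∈ Finset.Ioi i,
          ((-2 * dihedralAngle P (s i) (s j) + 4 * Real.pi * w i j : ℝ) : ℂ))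
        - ∑ i, ((-2 * Real.pi * (SignType.sign (s i).a : ℝ) : ℝ) : ℂ))) :=
    (tendsto_finsetSum _ fun i _ => tendsto_finsetSum _ fun j hj => (hpair i j hj).tendsto).sub
      (tendsto_finsetSum _ fun i _ => (s i).hasIteratedMu_outside.tendsto)
  -- 4π times the count at infinity replaces the pair weights; the signs of the a_i then cancel
  -- against the masses of the single complements.
  have hval : 2 * ((m : ℝ) - 2) * Real.pi
        - 2 * ∑ i : Fin m, ∑ j ∈ Finset.Ioi i, dihedralAngle P (s i) (s j)
      = (∑ i, ∑ j ∈ Finset.Ioi i, (-2 * dihedralAngle P (s i) (s j) + 4 * Real.pi * w i j))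
        - ∑ i, -2 * Real.pi * (SignType.sign (s i).a : ℝ) := by
    have h1 : ∑ i : Fin m, (1 - (SignType.sign (s i).a : ℝ)) / 2
        = (m - ∑ i, (SignType.sign (s i).a : ℝ)) / 2 := by
      rw [← Finset.sum_div, Finset.sum_sub_distrib]
      simp
    change _ - ∑ i, ∑ j ∈ Finset.Ioi i, w i j = 1 at hcount
    rw [h1] at hcount
    simp only [Finset.sum_add_distrib, ← Finset.mul_sum]
    linear_combination (4 * Real.pi) * hcount
  rw [hval, HasMu]
  push_cast at hlim ⊢
  refine hlim.congr' ?_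
  filter_upwards [self_mem_nhdsWithin] with ε hε
  have hε : 0 < ε := hε
  have hi : ∀ i, Integrable fun v => ∑ j ∈ Finset.Ioi i, sectionIntegral ε (pairSection s i j v) :=
    fun i => integrable_finsetSum _ fun j hj => (hpair i j hj).integrable ε hε
  have ho : ∀ i, Integrable fun v => sectionIntegral ε ((s i).outside v) :=
    fun i => (s i).hasIteratedMu_outside.integrable ε hε
  rw [muEps_eq_integral_sectionIntegral hPF hH₀ ha hε,
    integral_congr_ae (sectionIntegral_polySection hs hy hspos hm hreg hε),
    integral_sub (integrable_finsetSum _ fun i _ => hi i) (integrable_finsetSum _ fun i _ => ho i),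
    integral_finsetSum _ fun i _ => hi i, integral_finsetSum _ fun i _ => ho i]
  congr 1
  refine Finset.sum_congr rfl fun i _ => ?_
  rw [integral_finsetSum _ fun j hj => (hpair i j hj).integrable ε hε]
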